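/- **Setting.** Let $\mathcal X$ be a measurable space, let $\mathcal F$ be a class of measurable functions $\mathcal X\to\{\pm1\}$ of finite VC dimension $d\ge 1$, satisfying the usual measurability condition that some countable $\mathcal F_0\subseteq\mathcal F$ has every $f\in\mathcal F$ as the pointwise limit of a sequence in $\mathcal F_0$. For a probability distribution $P$ on $\mathcal X\times\{\pm1\}$ with marginal $P_X$ put $R(f)=P(f(x)\ne y)$; a true risk minimizer is an $f^*\in\mathcal F$ with $R(f^*)=\min_{f\in\mathcal F}R(f)$. Let $\hat R(f,S)$ be the fraction of errors of $f$ on a finite labelled sample $S$, let $AGR(G)$ be the set of points on which all members of $G\subseteq\mathcal F$ agree, $DIS(G)$ its complement, $B(f,r)=\{f'\in\mathcal F: P_X(f'\ne f)\le r\}$, and $$\theta'(r_0)=\sup_{r>r_0}\frac{P_X(DIS(B(f^*,r)))}{r}.$$ Let $A(n,\delta)=4d\ln\frac{16ne}{d\delta}$ and $\sigma_{n,\delta}(\rho)=\frac{A(n,\delta)}{n}+\sqrt{\frac{A(n,\delta)}{n}\,\rho}$. **Active-ILESS$(m,\delta)$** processes an i.i.d. stream $(x_1,y_1),(x_2,y_2),\dots$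 from $P$, starting with $\hat S=\emptyset$, $G_0=\mathcal F$. At time $t=1,\dots,m$: if $x_t\in AGR(G_{t-1})$, no label is requested and $x_t$ gets the common label of the members of $G_{t-1}$; otherwise the label $y_t$ is requested. The labelled example is added to $\hat S$. If $t$ is a power of $2$ (including $t=1$), let $\hat f$ be any minimizer of $\hat R(\cdot,\hat S)$ in $\mathcal F$, let $\hat\rho=\hat R(\hat f,\hat S)$, $n=t/2$, $\delta_t=\delta/(2t)$, $\sigma=\sigma_{n,\delta_t}(\hat\rho)+\sigma_{n,\delta_t}\bigl(\hat\rho+\sigma_{n,\delta_t}(\hat\rho)\bigr)$, set $G_t=\{f\in\mathcal F:\hat R(f,\hat S)\le\hat\rho+\sigma\}$ and reset $\hat S=\emptyset$; otherwise $G_t=G_{t-1}$. **Polylogarithms.** A function ${\rm polylog}_1$ is called poly-logarithmic if it is nonnegative and nondecreasing on $(0,\infty)$ and ${\rm polylog}_1(x)\le C(1+\ln x)^k$ for $x\ge1$, for some $C,k$. A term ${\rm polylog}_3(m,d,1/\delta)\ge 0$ is one that is at most $C\,d\,\bigl((1+\ln m)(1+\ln\frac1\delta)\bigr)^k$ for some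 $C,k$. **Theorem.** Let ${\rm polylog}_1$ be poly-logarithmic. There are a poly-logarithmic ${\rm polylog}_2$ and a term ${\rm polylog}_3$, depending only on ${\rm polylog}_1$, such that for all $\mathcal X,\mathcal F,d$ as above and every $f^*\in\mathcal F$: (a) Let $P$ be such that $f^*$ is a true risk minimizer and $\theta'(r)\le{\rm polylog}_1(1/r)$ for all $r>R(f^*)$, let $m\ge d$, $0<\delta<1$, and $A=4d\ln\frac{16me}{d\delta}$. Then with probability at least $1-\delta$ the number of labels requested by Active-ILESS$(m,\delta/2)$ is at most $${\rm polylog}_1\!\Bigl(\tfrac{1}{5R(f^*)+14A/m}\Bigr)\,10e\cdot mR(f^*)+\log_2\tfrac2\delta+56e\cdot\log_2 m\cdot A\cdot{\rm polylog}_1\!\Bigl(\tfrac{1}{5R(f^*)+14A/m}\Bigr),$$ and this quantity is at most ${\rm polylog}_2\bigl(\frac{1}{R(f^*)+1/m}\bigr)R(f^*)\,m+{\rm polylog}_3(m,d,1/\delta)$. (b) Consequently, if for a marginal $P_X$ one has $\theta'(r)\le{\rm polylog}_1(1/r)$ for all $r>0$, then Active-ILESS has $R^*$ exponential speedup with parameters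 ${\rm polylog}_2,{\rm polylog}_3$: for every $P$ with marginal $P_X$ for which $f^*$ is a true risk minimizer, every $m>0$ and every $0<\delta<1$, with probability at least $1-\delta$ the number of labels requested by Active-ILESS$(m,\delta/2)$ is at most ${\rm polylog}_2\bigl(\frac{1}{R(f^*)+1/m}\bigr)R(f^*)\,m+{\rm polylog}_3(m,d,1/\delta)$. -/

import Mathlib

open MeasureTheory Filter Topology

noncomputable section

namespace ActiveILESS

variable {X : Type*}

/-! ### Learning problems

Classifiers are maps `X → Bool`; the two labels `±1` are coded by `Bool`. -/

/-- A finite set of points is shattered by `F` if every labelling of it is realised in `F`. -/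
def Shatters (F : Set (X → Bool)) (S : Finset X) : Prop :=
  ∀ b : X → Bool, ∃ f ∈ F, ∀ x ∈ S, f x = b x

/-- `F` has (finite) Vapnik–Chervonenkis dimension `d`. -/
def HasVCDim (F : Set (X → Bool)) (d : ℕ) : Prop :=
  (∃ S : Finset X, S.card = d ∧ Shatters F S) ∧ ∀ S : Finset X, Shatters F S → S.card ≤ d

/-- The usual measurability condition on a hypothesis class: its members are measurable and
it has a countable subclass whose pointwise sequential limits exhaust it. -/
def PointwiseMeasurable [MeasurableSpace X] (F : Set (X → Bool)) : Prop :=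
  (∀ f ∈ F, Measurable f) ∧
    ∃ F₀ ⊆ F, F₀.Countable ∧
      ∀ f ∈ F, ∃ g : ℕ → X → Bool,
        (∀ n, g n ∈ F₀) ∧ ∀ x, Tendsto (fun n => g n x) atTop (𝓝 (f x))

/-- The true zero-one error of `f`. -/
def risk [MeasurableSpace X] (P : Measure (X × Bool)) (f : X → Bool) : ℝ :=
  P.real {z | f z.1 ≠ z.2}

/-- `f` is a true risk minimizer in `F`. -/
def IsRiskMinimizer [MeasurableSpace X] (P : Measure (X × Bool)) (F : Set (X → Bool))
    (f : X → Bool) : Prop :=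
  f ∈ F ∧ ∀ g ∈ F, risk P f ≤ risk P g

/-- The empirical zero-one error of `f` on a finite labelled sample (with repetitions). -/
def empRisk (f : X → Bool) (S : List (X × Bool)) : ℝ :=
  (S.countP fun z => f z.1 != z.2 : ℕ) / (S.length : ℝ)

/-- `f` is an empirical risk minimizer in `F` for the sample `S`. -/
def IsERM (F : Set (X → Bool)) (S : List (X × Bool)) (f : X → Bool) : Prop :=
  f ∈ F ∧ ∀ g ∈ F, empRisk f S ≤ empRisk g S

/-- The empirical low-error set `V̂(f, r)` for the sample `S`. -/
def empLowError (F : Set (X → Bool)) (S : List (X × Bool)) (f : X → Bool) (r : ℝ) :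
    Set (X → Bool) :=
  {f' ∈ F | empRisk f' S ≤ empRisk f S + r}

/-! ### Disagreement -/

/-- The disagreement set of `G`. -/
def DIS (G : Set (X → Bool)) : Set X :=
  {x | ∃ f₁ ∈ G, ∃ f₂ ∈ G, f₁ x ≠ f₂ x}

/-- The agreement set of `G`. -/
def AGR (G : Set (X → Bool)) : Set X :=
  {x | ∀ f₁ ∈ G, ∀ f₂ ∈ G, f₁ x = f₂ x}

/-- The ball `B(f, r)` in `F` with respect to the marginal `PX`. -/
def ball [MeasurableSpace X] (PX : Measure X) (F : Set (X → Bool)) (f : X → Bool) (r : ℝ) :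
    Set (X → Bool) :=
  {f' ∈ F | PX.real {x | f' x ≠ f x} ≤ r}

/-- The disagreement coefficient `θ_f(r₀) = sup_{r > r₀} Δ B(f, r) / r`. For `r₀ > 0` the
supremum is over a nonempty set bounded by `1 / r₀`. -/
def disCoeff [MeasurableSpace X] (PX : Measure X) (F : Set (X → Bool)) (f : X → Bool)
    (r₀ : ℝ) : ℝ :=
  ⨆ r : Set.Ioi r₀, PX.real (DIS (ball PX F f r)) / (r : ℝ)

/-! ### The algorithm -/

/-- `A(n, δ, d) = 4 d ln (16 n e / (d δ))`. The sample size `n` is a real number because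
the algorithm uses `n = t / 2`. -/
def slackA (n δ : ℝ) (d : ℕ) : ℝ :=
  4 * d * Real.log (16 * n * Real.exp 1 / (d * δ))

/-- The empirical slack for `R - R̂`, in terms of the empirical error. -/
def sigmaHat (n δ : ℝ) (d : ℕ) (empErr : ℝ) : ℝ :=
  slackA n δ d / n + √(slackA n δ d / n * empErr)

/-- The non-empirical slack for `R̂ - R`, in terms of the true error. -/
def sigmaBar (n δ : ℝ) (d : ℕ) (err : ℝ) : ℝ :=
  slackA n δ d / n + √(slackA n δ d / n * err)

/-- The radius `σ_Active` at time `t`, where `empErr` is the empirical error of the ERM. -/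
def sigmaActive (t : ℕ) (δ : ℝ) (d : ℕ) (empErr : ℝ) : ℝ :=
  sigmaHat (t / 2) (δ / (2 * t)) d empErr +
    sigmaBar (t / 2) (δ / (2 * t)) d (empErr + sigmaHat (t / 2) (δ / (2 * t)) d empErr)

/-- The state of Active-ILESS: the current sample `Ŝ`, the current low-error set `G_t`, and
the number of labels requested so far. -/
structure State (X : Type*) where
  sample : List (X × Bool)
  lowError : Set (X → Bool)
  requested : ℕ

open Classical in
/-- The label given to `x` by the members of `G` if they agree at `x`. -/
def commonLabel (G : Set (X → Bool)) (x : X) : Bool :=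
  decide (∃ f ∈ G, f x = true)

theorem commonLabel_eq {G : Set (X → Bool)} {x : X} (hx : x ∈ AGR G) {f : X → Bool}
    (hf : f ∈ G) : commonLabel G x = f x := by
  unfold commonLabel
  cases h : f x
  · simp only [decide_eq_false_iff_not, not_exists, not_and]
    intro g hg hgx
    have := hx f hf g hg
    simp [h, hgx] at this
  · simpa using ⟨f, hf, h⟩

open Classical in
/-- Processing of the `t`-th example `z = (x_t, y_t)`. The true label `z.2` is only looked at
if it is requested. `erm` is the rule by which empirical risk minimizers are chosen. -/
def step (F : Set (X → Bool)) (d : ℕ) (erm : List (X × Bool) → X → Bool) (δ : ℝ)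
    (t : ℕ) (s : State X) (z : X × Bool) : State X :=
  let y := if z.1 ∈ AGR s.lowError then commonLabel s.lowError z.1 else z.2
  let S := (z.1, y) :: s.sample
  let n := if z.1 ∈ AGR s.lowError then s.requested else s.requested + 1
  if ∃ i : ℕ, t = 2 ^ i then
    { sample := []
      lowError := empLowError F S (erm S) (sigmaActive t δ d (empRisk (erm S) S))
      requested := n }
  else
    { sample := S
      lowError := s.lowError
      requested := n }

/-- The state after `t` examples of the stream `z 0, z 1, …`; `z t` is example number
`t + 1`. -/
def run (F : Set (X → Bool)) (d : ℕ) (erm : List (X × Bool) → X → Bool) (δ : ℝ)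
    (z : ℕ → X × Bool) : ℕ → State X
  | 0 => { sample := [], lowError := F, requested := 0 }
  | t + 1 => step F d erm δ (t + 1) (run F d erm δ z t) (z t)

/-- The number of labels requested by Active-ILESS`(m, δ)` on the stream `z`. -/
def labelsRequested (F : Set (X → Bool)) (d : ℕ) (erm : List (X × Bool) → X → Bool)
    (m : ℕ) (δ : ℝ) (z : ℕ → X × Bool) : ℕ :=
  (run F d erm δ z m).requested

/-! ### Poly-logarithmic bounds and exponential speedup -/

/-- A poly-logarithmic function of one variable: nonnegative and nondecreasing on `(0, ∞)`,
and bounded on `[1, ∞)` by a constant times a power of `1 + ln x`. -/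
def IsPolylog (φ : ℝ → ℝ) : Prop :=
  (∀ x, 0 < x → 0 ≤ φ x) ∧ MonotoneOn φ (Set.Ioi 0) ∧
    ∃ (C : ℝ) (k : ℕ), ∀ x, 1 ≤ x → φ x ≤ C * (1 + Real.log x) ^ k

/-- A term `polylog(m, d, 1/δ)`: poly-logarithmic in `m` and `1/δ`, at most linear in the VC
dimension `d` (as `A` is). The third argument stands for `1/δ`. -/
def IsPolylogTerm (ψ : ℕ → ℕ → ℝ → ℝ) : Prop :=
  ∃ (C : ℝ) (k : ℕ), ∀ (m d : ℕ) (x : ℝ), 1 ≤ m → 1 ≤ d → 1 ≤ x →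
    0 ≤ ψ m d x ∧ ψ m d x ≤ C * d * ((1 + Real.log m) * (1 + Real.log x)) ^ k

/-- `R*` exponential speedup, for given `PX`, `F` (of VC dimension `d`) and `fstar`, with
parameters `φ` and `ψ`, of an active learner that requests `labels m δ z` labels on the first
`m` examples of the stream `z` when run at overall confidence `δ`. -/
def HasRStarExponentialSpeedup [MeasurableSpace X] (PX : Measure X) (F : Set (X → Bool))
    (d : ℕ) (fstar : X → Bool) (labels : ℕ → ℝ → (ℕ → X × Bool) → ℕ)
    (φ : ℝ → ℝ) (ψ : ℕ → ℕ → ℝ → ℝ) : Prop :=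
  ∀ (P : Measure (X × Bool)) [IsProbabilityMeasure P], P.fst = PX →
    IsRiskMinimizer P F fstar →
    ∀ (m : ℕ) (δ : ℝ), 0 < m → 0 < δ → δ < 1 →
      Measure.infinitePi (fun _ : ℕ => P)
        {z | φ (1 / (risk P fstar + 1 / m)) * risk P fstar * m + ψ m d (1 / δ)
              < labels m δ z} ≤ ENNReal.ofReal δ

/-- The bound on the number of labels, with `R = R(f*)` and `A = A(m, δ, d)`. -/
def labelBound (φ : ℝ → ℝ) (R : ℝ) (m d : ℕ) (δ : ℝ) : ℝ :=
  φ (1 / (5 * R + 14 * (slackA m δ d / m))) * (10 * Real.exp 1) * (m * R)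
    + Real.logb 2 (2 / δ)
    + 56 * Real.exp 1 * Real.logb 2 m * slackA m δ d
        * φ (1 / (5 * R + 14 * (slackA m δ d / m)))

end ActiveILESS

end

open ActiveILESS

open MeasureTheory Filter Topology

noncomputable section

namespace ActiveILESS

/-! Write `g` for `f*`, `R` for its risk, and split `{f ≠ g}` into the part where `g` errs and the
part where `g` is right. As long as `g` lies in the low-error set, a pseudo-label is either the true
label or the label of `g`, so false labels can only favour `g`: the empirical excess of `g` over `f`
is at most the frequency of the first part minus that of the second, and the second frequency is at
most the empirical error of `f`. Since `g` minimizes the risk, the first part has the smaller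
probability. Relative deviation bounds, from frequency to probability on the second part and back on
the first, compose to exactly the radius of the algorithm, so `g` survives each stage. The same
bounds confine the low-error set to a ball of radius `5R + 7a` around `g`, where `a` is the relative
slack `A/n` of the stage (`GoodSample.stage`, `GoodStream.lowError`).

The uniform deviation bounds come from symmetrization (`measure_exists_bad_le`): the sample is
treated as a random column of an array with 32 columns, Sauer's lemma counts the traces on the
array, and Chernoff bounds handle each trace. With the `A` of a stage, `exp (-A/4)` cancels the
growth function of the array and leaves a failure probability that is summable over the stages
(`measure_not_goodStream_le`).

On a good stream a request at time `t` forces `x_t` into a disagreement set that does not depend on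
the data. The number of requests is thus dominated by a sum of independent indicators. The
disagreement coefficient bounds its mean, the stages contributing one `A` per dyadic block
(`sum_real_DIS_le`), and `measure_lt_hits_le` gives `2e` times this bound plus `log₂ (2/δ)`. The
final polylogarithmic form only uses monotonicity of `φ`. -/

/-! ### Tail bounds for sums of independent indicators -/

section Tails

variable {ι : Type*} {Ω : ι → Type*}

/-- The number of coordinates `i ∈ s` with `ω i ∈ B i`. -/
def hits (s : Finset ι) (B : ∀ i, Set (Ω i)) (ω : ∀ i, Ω i) : ℝ :=
  ∑ i ∈ s, (B i).indicator (fun _ => (1 : ℝ)) (ω i)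

theorem hits_nonneg (s : Finset ι) (B : ∀ i, Set (Ω i)) (ω : ∀ i, Ω i) : 0 ≤ hits s B ω :=
  Finset.sum_nonneg fun _ _ => Set.indicator_nonneg (fun _ _ => zero_le_one) _

variable [∀ i, MeasurableSpace (Ω i)]

theorem measurable_hits (s : Finset ι) {B : ∀ i, Set (Ω i)} (hB : ∀ i, MeasurableSet (B i)) :
    Measurable (hits s B) := by
  unfold hits
  refine Finset.measurable_sum _ fun i _ => ?_
  exact (measurable_const.indicator (hB i)).comp (measurable_pi_apply i)

/-- The exponential is affine in the indicator, so the integral is `1 + (e^l - 1) μ(B)`; then `1 + y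
≤ e^y`. -/
theorem lintegral_exp_indicator_le {α : Type*} [MeasurableSpace α] (μ : Measure α)
    [IsProbabilityMeasure μ] {B : Set α} (hB : MeasurableSet B) (l : ℝ) :
    ∫⁻ x, ENNReal.ofReal (Real.exp (l * B.indicator (fun _ => (1 : ℝ)) x)) ∂μ
      ≤ ENNReal.ofReal (Real.exp ((Real.exp l - 1) * μ.real B)) := by
  have hle : ∀ x, Real.exp (l * B.indicator (fun _ => (1 : ℝ)) x)
      = 1 + B.indicator (fun _ => Real.exp l - 1) x := by
    intro x
    by_cases hx : x ∈ B <;> simp [hx]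
  have hint : Integrable (fun x => B.indicator (fun _ => Real.exp l - 1) x) μ :=
    (integrable_const _).indicator hB
  have hint' : Integrable (fun x => Real.exp (l * B.indicator (fun _ => (1 : ℝ)) x)) μ := by
    simp_rw [hle]
    exact (integrable_const _).add hint
  rw [← ofReal_integral_eq_lintegral_ofReal hint' (ae_of_all _ fun x => (Real.exp_pos _).le)]
  apply ENNReal.ofReal_le_ofReal
  simp_rw [hle]
  rw [integral_add (integrable_const _) hint, integral_indicator_const _ hB]
  simp only [integral_const, probReal_univ, smul_eq_mul, one_mul]
  have := Real.add_one_le_exp ((Real.exp l - 1) * μ.real B)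
  linarith

variable (μ : ∀ i, Measure (Ω i)) [∀ i, IsProbabilityMeasure (μ i)]

theorem lintegral_exp_hits_le (s : Finset ι) {B : ∀ i, Set (Ω i)}
    (hB : ∀ i, MeasurableSet (B i)) (l : ℝ) :
    ∫⁻ ω, ENNReal.ofReal (Real.exp (l * hits s B ω)) ∂(Measure.infinitePi μ)
      ≤ ENNReal.ofReal (Real.exp ((Real.exp l - 1) * ∑ i ∈ s, (μ i).real (B i))) := by
  have hm : ∀ i, Measurable fun x : Ω i =>
      ENNReal.ofReal (Real.exp (l * (B i).indicator (fun _ => (1 : ℝ)) x)) := fun i =>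
    (Real.measurable_exp.comp
      ((measurable_const.indicator (hB i)).const_mul l)).ennreal_ofReal
  have hind := ProbabilityTheory.iIndepFun_infinitePi (P := μ)
    (X := fun i x => ENNReal.ofReal (Real.exp (l * (B i).indicator (fun _ => (1 : ℝ)) x))) hm
  have hprod : ∀ ω, ENNReal.ofReal (Real.exp (l * hits s B ω)) = ∏ i ∈ s,
      ENNReal.ofReal (Real.exp (l * (B i).indicator (fun _ => (1 : ℝ)) (ω i))) := by
    intro ω
    rw [← ENNReal.ofReal_prod_of_nonneg fun i _ => (Real.exp_pos _).le, ← Real.exp_sum, hits,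
      Finset.mul_sum]
  simp_rw [hprod]
  rw [ProbabilityTheory.lintegral_prod_eq_prod_lintegral_of_indepFun s _ hind
    (fun i => (hm i).comp (measurable_pi_apply i)), Finset.mul_sum, Real.exp_sum,
    ENNReal.ofReal_prod_of_nonneg fun i _ => (Real.exp_pos _).le]
  refine Finset.prod_le_prod' fun i _ => ?_
  refine le_trans (le_of_eq ?_) (lintegral_exp_indicator_le (μ i) (hB i) l)
  rw [← (measurePreserving_eval_infinitePi μ i).lintegral_comp (hm i)]

/-- Markov's inequality for the exponential moment. The sign of `l` is free, so this single bound
serves both tails. -/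
theorem measure_hits_le_exp (s : Finset ι) {B : ∀ i, Set (Ω i)}
    (hB : ∀ i, MeasurableSet (B i)) (l c : ℝ) :
    Measure.infinitePi μ {ω | c ≤ l * hits s B ω}
      ≤ ENNReal.ofReal (Real.exp ((Real.exp l - 1) * ∑ i ∈ s, (μ i).real (B i) - c)) := by
  have hmk := mul_meas_ge_le_lintegral (μ := Measure.infinitePi μ)
    (f := fun ω => ENNReal.ofReal (Real.exp (l * hits s B ω)))
    ((Real.measurable_exp.comp ((measurable_hits s hB).const_mul l)).ennreal_ofReal)
    (ENNReal.ofReal (Real.exp c))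
  have hsub : {ω | c ≤ l * hits s B ω} ⊆ {ω | ENNReal.ofReal (Real.exp c)
      ≤ ENNReal.ofReal (Real.exp (l * hits s B ω))} := fun ω hω =>
    ENNReal.ofReal_le_ofReal (Real.exp_le_exp.2 hω)
  have h1 := hmk.trans (lintegral_exp_hits_le μ s hB l)
  refine (measure_mono hsub).trans ?_
  rw [Real.exp_sub, ENNReal.ofReal_div_of_pos (Real.exp_pos c), ENNReal.le_div_iff_mul_le
    (Or.inl (by simp [Real.exp_pos])) (Or.inl ENNReal.ofReal_ne_top), mul_comm]
  exact h1

/-- Upper tail of a sum of independent indicators. -/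
theorem measure_hits_ge_le (s : Finset ι) {B : ∀ i, Set (Ω i)}
    (hB : ∀ i, MeasurableSet (B i)) {M x : ℝ} (hM : ∑ i ∈ s, (μ i).real (B i) ≤ M)
    (hx : 0 ≤ x) :
    Measure.infinitePi μ {ω | M + x ≤ hits s B ω}
      ≤ ENNReal.ofReal (Real.exp (-(x ^ 2 / (2 * (M + x))))) := by
  have hsum0 : 0 ≤ ∑ i ∈ s, (μ i).real (B i) := Finset.sum_nonneg fun i _ => measureReal_nonneg
  rcases (hsum0.trans hM).eq_or_lt with hM0 | hM0
  -- For `M = 0` the choice `l = x / (M + x)` below would make `1 - l` vanish; `l = 1` suffices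
  -- here.
  · subst hM0
    have h := measure_hits_le_exp μ s hB 1 (0 + x)
    simp only [one_mul] at h
    refine h.trans (ENNReal.ofReal_le_ofReal (Real.exp_le_exp.2 ?_))
    rw [le_antisymm hM hsum0, mul_zero, zero_add, zero_sub, neg_le_neg_iff]
    rcases hx.eq_or_lt with hx0 | hx0
    · simp [← hx0]
    · rw [div_le_iff₀ (by positivity)]
      nlinarith
  set l : ℝ := x / (M + x) with hl
  have hMx : 0 < M + x := by linarith
  have hl0 : 0 ≤ l := div_nonneg hx hMx.le
  have hl1 : 1 - l = M / (M + x) := by rw [hl]; field_simp; ring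
  have hl1' : 0 < 1 - l := by rw [hl1]; positivity
  have hexp : Real.exp l - 1 ≤ l + l ^ 2 / (2 * (1 - l)) := by
    have h4 : Real.exp l * (2 * (1 - l)) ≤ 2 - l ^ 2 := by
      -- The derivative is `2y(1 - e^y) ≤ 0`, and the value at `0` is `2`.
      have hanti : AntitoneOn (fun y : ℝ => Real.exp y * (2 * (1 - y)) + y ^ 2) (Set.Ici 0) := by
        apply antitoneOn_of_deriv_nonpos (convex_Ici 0) (by fun_prop) (by fun_prop)
        intro y hy
        rw [interior_Ici] at hy
        have hd : HasDerivAt (fun y : ℝ => Real.exp y * (2 * (1 - y)) + y ^ 2)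
            (Real.exp y * (2 * (1 - y)) + Real.exp y * (2 * (-1)) + 2 * y) y := by
          have h1 : HasDerivAt (fun y : ℝ => 2 * (1 - y)) (2 * (-1)) y :=
            ((hasDerivAt_id y).const_sub 1).const_mul 2
          have h2 : HasDerivAt (fun y : ℝ => y ^ 2) (2 * y) y := by
            simpa using hasDerivAt_pow 2 y
          exact ((Real.hasDerivAt_exp y).mul h1).add h2
        rw [hd.deriv]
        have := Real.add_one_le_exp y
        have hy' : (0 : ℝ) < y := hy
        nlinarith
      have := hanti (Set.mem_Ici.2 le_rfl) (Set.mem_Ici.2 hl0) hl0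
      norm_num at this
      linarith
    rw [← sub_nonneg]
    have : l + l ^ 2 / (2 * (1 - l)) - (Real.exp l - 1)
        = (2 - l ^ 2 - Real.exp l * (2 * (1 - l))) / (2 * (1 - l)) := by
      field_simp; ring
    rw [this]
    exact div_nonneg (by linarith) (by linarith)
  have hsub : {ω | M + x ≤ hits s B ω} ⊆ {ω | l * (M + x) ≤ l * hits s B ω} := fun ω hω =>
    mul_le_mul_of_nonneg_left hω hl0
  refine (measure_mono hsub).trans ((measure_hits_le_exp μ s hB l _).trans ?_)
  apply ENNReal.ofReal_le_ofReal
  apply Real.exp_le_exp.2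
  have hel : 0 ≤ Real.exp l - 1 := by have := Real.add_one_le_exp l; linarith
  have h5 : (Real.exp l - 1) * ∑ i ∈ s, (μ i).real (B i) ≤ (l + l ^ 2 / (2 * (1 - l))) * M :=
    (mul_le_mul_of_nonneg_left hM hel).trans (mul_le_mul_of_nonneg_right hexp hM0.le)
  have h6 : (l + l ^ 2 / (2 * (1 - l))) * M - l * (M + x) = -(x ^ 2 / (2 * (M + x))) := by
    rw [hl1, hl]; field_simp; ring
  linarith

/-- Lower tail of a sum of independent indicators. -/
theorem measure_hits_le_le (s : Finset ι) {B : ∀ i, Set (Ω i)}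
    (hB : ∀ i, MeasurableSet (B i)) {M x : ℝ} (hM : ∑ i ∈ s, (μ i).real (B i) = M)
    (hM0 : 0 < M) (hx : 0 ≤ x) :
    Measure.infinitePi μ {ω | hits s B ω ≤ M - x}
      ≤ ENNReal.ofReal (Real.exp (-(x ^ 2 / (2 * M)))) := by
  set l : ℝ := x / M with hl
  have hl0 : 0 ≤ l := div_nonneg hx hM0.le
  have hexp : Real.exp (-l) - 1 ≤ -l + l ^ 2 / 2 := by
    have hmono : MonotoneOn (fun y : ℝ => 1 - y + y ^ 2 / 2 - Real.exp (-y)) (Set.Ici 0) := by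
      apply monotoneOn_of_deriv_nonneg (convex_Ici 0) (by fun_prop) (by fun_prop)
      intro y hy
      have hd : HasDerivAt (fun y : ℝ => 1 - y + y ^ 2 / 2 - Real.exp (-y))
          (-1 + 2 * y / 2 - Real.exp (-y) * (-1)) y := by
        have h2 : HasDerivAt (fun y : ℝ => y ^ 2 / 2) (2 * y / 2) y := by
          simpa using (hasDerivAt_pow 2 y).div_const 2
        exact (((hasDerivAt_id y).const_sub 1).add h2).sub ((hasDerivAt_neg y).exp)
      rw [hd.deriv]
      have := Real.add_one_le_exp (-y)
      linarith
    have := hmono (Set.mem_Ici.2 le_rfl) (Set.mem_Ici.2 hl0) hl0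
    norm_num at this
    linarith
  have hsub : {ω | hits s B ω ≤ M - x} ⊆ {ω | -l * (M - x) ≤ -l * hits s B ω} := fun ω hω => by
    have := mul_le_mul_of_nonneg_left (show hits s B ω ≤ M - x from hω) hl0
    simp only [Set.mem_ofPred_eq]
    linarith
  refine (measure_mono hsub).trans ((measure_hits_le_exp μ s hB (-l) _).trans ?_)
  apply ENNReal.ofReal_le_ofReal
  apply Real.exp_le_exp.2
  rw [hM]
  have h5 := mul_le_mul_of_nonneg_right hexp hM0.le
  have h6 : (-l + l ^ 2 / 2) * M - -l * (M - x) = -(x ^ 2 / (2 * M)) := by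
    rw [hl]; field_simp; ring
  linarith

/-- A sum of independent indicators of mean at most `M` exceeds `2 e M + log₂ (1 / η)` with
probability at most `η`. -/
theorem measure_lt_hits_le (s : Finset ι) {B : ∀ i, Set (Ω i)}
    (hB : ∀ i, MeasurableSet (B i)) {M η : ℝ} (hM : ∑ i ∈ s, (μ i).real (B i) ≤ M)
    (hη : 0 < η) :
    Measure.infinitePi μ {ω | 2 * Real.exp 1 * M + Real.logb 2 (1 / η) < hits s B ω}
      ≤ ENNReal.ofReal η := by
  have hM0 : 0 ≤ M := (Finset.sum_nonneg fun i _ => measureReal_nonneg).trans hM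
  have hlog2 : 0 < Real.log 2 := Real.log_pos one_lt_two
  have hsub : {ω | 2 * Real.exp 1 * M + Real.logb 2 (1 / η) < hits s B ω} ⊆
      {ω | Real.log 2 * (2 * Real.exp 1 * M + Real.logb 2 (1 / η))
        ≤ Real.log 2 * hits s B ω} := fun ω hω =>
    mul_le_mul_of_nonneg_left (le_of_lt hω) hlog2.le
  refine (measure_mono hsub).trans ((measure_hits_le_exp μ s hB (Real.log 2) _).trans ?_)
  apply ENNReal.ofReal_le_ofReal
  rw [← Real.le_log_iff_exp_le hη, Real.exp_log two_pos]
  have h1 : Real.log 2 * Real.logb 2 (1 / η) = -Real.log η := by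
    rw [Real.logb, mul_div_cancel₀ _ hlog2.ne', one_div, Real.log_inv]
  have h2 := Real.exp_one_gt_d9
  have h3 := Real.log_two_gt_d9
  -- With `l = log 2` the exponential moment contributes the mean once, and `2e log 2 ≥ 1` absorbs
  -- it.
  have h4 : (1 : ℝ) ≤ Real.log 2 * (2 * Real.exp 1) := by nlinarith
  rw [mul_add, h1]
  nlinarith
end Tails

/-! ### The growth function -/

section Growth

variable {X : Type*}

/-- Sauer's lemma for the traces of a class on a finite family of points. -/
theorem ncard_trace_le {F : Set (X → Bool)} {d : ℕ}
    (hF : ∀ S : Finset X, Shatters F S → S.card ≤ d) {J : Type*} [Fintype J] (x : J → X) :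
    ((fun f : X → Bool => f ∘ x) '' F).ncard
      ≤ ∑ k ∈ Finset.Iic d, (Fintype.card J).choose k := by
  classical
  let 𝒜 : Finset (Finset J) :=
    Finset.univ.filter fun A => ∃ f ∈ F, ∀ j, j ∈ A ↔ f (x j) = true
  have hcard : ((fun f : X → Bool => f ∘ x) '' F).ncard ≤ 𝒜.card := by
    rw [← Set.ncard_coe_finset]
    refine Set.ncard_le_ncard_of_injOn (fun g : J → Bool => Finset.univ.filter fun j => g j = true)
      ?_ ?_ (Finset.finite_toSet _)
    · rintro _ ⟨f, hf, rfl⟩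
      simp only [Finset.coe_filter, Finset.mem_univ, true_and, Set.mem_ofPred_eq, 𝒜]
      exact ⟨f, hf, fun j => by simp⟩
    · intro g _ g' _ h
      funext j
      have := Finset.ext_iff.1 h j
      simp only [Finset.mem_filter, Finset.mem_univ, true_and] at this
      exact Bool.eq_iff_iff.2 this
  have hvc : 𝒜.vcDim ≤ d := by
    refine Finset.sup_le fun S hS => ?_
    rw [Finset.mem_shatterer] at hS
    have hmem : ∀ t ⊆ S, ∃ f ∈ F, ∀ j ∈ S, j ∈ t ↔ f (x j) = true := by
      intro t ht
      obtain ⟨u, hu, hut⟩ := hS ht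
      obtain ⟨f, hf, hfu⟩ := (Finset.mem_filter.1 hu).2
      refine ⟨f, hf, fun j hj => ?_⟩
      rw [← hfu j, ← hut, Finset.mem_inter]
      simp [hj]
    -- The points `x j` may repeat, but a trace cannot separate equal points, so `x` is injective on
    -- any shattered index set and its image is shattered in `X`.
    have hinj : Set.InjOn x S := by
      intro j hj j' hj' hjj'
      by_contra hne
      obtain ⟨f, -, hf⟩ := hmem {j} (Finset.singleton_subset_iff.2 hj)
      have h1 := (hf j hj).1 (Finset.mem_singleton_self j)
      rw [hjj'] at h1
      exact hne (Finset.mem_singleton.1 ((hf j' hj').2 h1)).symm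
    rw [← Finset.card_image_of_injOn hinj]
    refine hF _ fun b => ?_
    obtain ⟨f, hf, hfb⟩ := hmem (S.filter fun j => b (x j) = true) (Finset.filter_subset _ _)
    refine ⟨f, hf, fun y hy => ?_⟩
    obtain ⟨j, hj, rfl⟩ := Finset.mem_image.1 hy
    have := hfb j hj
    simp only [Finset.mem_filter, hj, true_and] at this
    exact Bool.eq_iff_iff.2 this.symm
  calc _ ≤ 𝒜.card := hcard
    _ ≤ 𝒜.shatterer.card := Finset.card_le_card_shatterer 𝒜
    _ ≤ _ := Finset.card_shatterer_le_sum_vcDim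
    _ ≤ _ := Finset.sum_le_sum_of_subset (Finset.Iic_subset_Iic.2 hvc)

/-- With `q = d/N ≤ 1`, `q^d` times the sum is at most the binomial expansion of `(1 + q)^N ≤ e^(qN)
= e^d`. -/
theorem sum_choose_le_pow {N d : ℕ} (hd : 1 ≤ d) (hdN : d ≤ N) :
    ((∑ k ∈ Finset.Iic d, N.choose k : ℕ) : ℝ) ≤ (Real.exp 1 * N / d) ^ d := by
  have hd0 : (0 : ℝ) < d := by exact_mod_cast hd
  have hN0 : (0 : ℝ) < N := hd0.trans_le (by exact_mod_cast hdN)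
  set q : ℝ := d / N with hq
  have hq0 : 0 < q := by positivity
  have hq1 : q ≤ 1 := (div_le_one hN0).2 (by exact_mod_cast hdN)
  have h1 : q ^ d * ((∑ k ∈ Finset.Iic d, N.choose k : ℕ) : ℝ) ≤ (q + 1) ^ N := by
    rw [add_pow, Nat.cast_sum, Finset.mul_sum]
    calc ∑ k ∈ Finset.Iic d, q ^ d * (N.choose k : ℝ)
        ≤ ∑ k ∈ Finset.Iic d, q ^ k * 1 ^ (N - k) * (N.choose k : ℝ) := by
          refine Finset.sum_le_sum fun k hk => ?_
          rw [one_pow, mul_one]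
          exact mul_le_mul_of_nonneg_right
            (pow_le_pow_of_le_one hq0.le hq1 (Finset.mem_Iic.1 hk)) (Nat.cast_nonneg _)
      _ ≤ _ := by
          refine Finset.sum_le_sum_of_subset_of_nonneg ?_ fun k _ _ => by positivity
          intro k hk
          rw [Finset.mem_Iic] at hk
          rw [Finset.mem_range]
          omega
  have h2 : (q + 1) ^ N ≤ Real.exp 1 ^ d := by
    calc (q + 1) ^ N ≤ Real.exp q ^ N := by
          gcongr; exact Real.add_one_le_exp q
      _ = Real.exp 1 ^ d := by
          rw [← Real.exp_nat_mul, ← Real.exp_nat_mul, hq]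
          congr 1; field_simp
  have h3 : (Real.exp 1 * N / d) ^ d = Real.exp 1 ^ d / q ^ d := by
    rw [← div_pow, hq]; congr 1; field_simp
  rw [h3, le_div_iff₀ (by positivity), mul_comm]
  exact h1.trans h2

end Growth

/-! ### Symmetrization -/

section Ghost

variable {ι Z : Type*} {K : ℕ} [NeZero K]

/-- The uniform distribution on selections of one column in each row. -/
def selection (ι : Type*) (K : ℕ) [NeZero K] : Measure (ι → Fin K) :=
  Measure.infinitePi fun _ => ProbabilityTheory.uniformOn (Set.univ : Set (Fin K))

instance : IsProbabilityMeasure (ProbabilityTheory.uniformOn (Set.univ : Set (Fin K))) :=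
  ProbabilityTheory.isProbabilityMeasure_uniformOn Set.finite_univ Set.univ_nonempty

instance : IsProbabilityMeasure (selection ι K) := by
  unfold selection; infer_instance

/-- The rowwise cyclic shift by a selection. -/
def rowShift (j : ι → Fin K) : ι × Fin K ≃ ι × Fin K :=
  Equiv.prodShear (Equiv.refl ι) fun i => Equiv.addRight (j i)

theorem rowShift_apply (j : ι → Fin K) (i : ι) (l : Fin K) :
    rowShift j (i, l) = (i, l + j i) := rfl

variable [Fintype ι] [MeasurableSpace Z]

/-- The event that the first column is separated from the whole array by some member of `H`. -/
def arrayEvent (H : Set (Set Z)) (sep : ℝ → ℝ → Prop) : Set (ι × Fin K → Z) :=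
  {w | ∃ C ∈ H, sep (∑ i, C.indicator (fun _ => (1 : ℝ)) (w (i, 0)))
    (∑ q, C.indicator (fun _ => (1 : ℝ)) (w q))}

theorem measurableSet_arrayEvent {H : Set (Set Z)} (hH : H.Countable)
    (hHm : ∀ C ∈ H, MeasurableSet C) {sep : ℝ → ℝ → Prop}
    (hsep : MeasurableSet {q : ℝ × ℝ | sep q.1 q.2}) :
    MeasurableSet (arrayEvent H sep : Set (ι × Fin K → Z)) := by
  have : (arrayEvent H sep : Set (ι × Fin K → Z)) = ⋃ C ∈ H,
      (fun w : ι × Fin K → Z => ((∑ i, C.indicator (fun _ => (1 : ℝ)) (w (i, 0)),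
        ∑ q, C.indicator (fun _ => (1 : ℝ)) (w q)) : ℝ × ℝ)) ⁻¹' {q | sep q.1 q.2} := by
    ext w; simp [arrayEvent]
  rw [this]
  refine MeasurableSet.biUnion hH fun C hC => ?_
  have hind : Measurable (C.indicator fun _ => (1 : ℝ)) :=
    measurable_const.indicator (hHm C hC)
  refine Measurable.prodMk ?_ ?_ hsep
  · exact Finset.measurable_sum _ fun i _ => hind.comp (measurable_pi_apply _)
  · exact Finset.measurable_sum _ fun i _ => hind.comp (measurable_pi_apply _)

/-- The law of an i.i.d. array is invariant under every rowwise shift, so the shift may be averaged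
over. By Fubini the array can then be frozen; only the shift is random, the total count is
invariant, and a union bound over the at most `S` traces remains. -/
theorem measure_arrayEvent_le (P : Measure Z) [IsProbabilityMeasure P] {H : Set (Set Z)}
    (hH : H.Countable) (hHm : ∀ C ∈ H, MeasurableSet C) {sep : ℝ → ℝ → Prop}
    (hsep : MeasurableSet {q : ℝ × ℝ | sep q.1 q.2}) {S : ℕ}
    (hS : ∀ w : ι × Fin K → Z, ((fun C => w ⁻¹' C) '' H).ncard ≤ S) {ε : ENNReal}
    (hsel : ∀ T : Set (ι × Fin K), selection ι K
      {j | sep (hits Finset.univ (fun i => {l | (i, l) ∈ T}) j)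
        (∑ q, T.indicator (fun _ => (1 : ℝ)) q)} ≤ ε) :
    Measure.infinitePi (fun _ : ι × Fin K => P) (arrayEvent H sep) ≤ S * ε := by
  set E : Set (ι × Fin K → Z) := arrayEvent H sep
  set ν := Measure.infinitePi fun _ : ι × Fin K => P
  have hE : MeasurableSet E := measurableSet_arrayEvent hH hHm hsep
  have hshift : ∀ j : ι → Fin K, ν ((fun w q => w (rowShift j q)) ⁻¹' E) = ν E := by
    intro j
    have h := Measure.map_infinitePi_infinitePi_of_inj (P := fun _ : ι × Fin K => P)
      (rowShift j).injective
    rw [← Measure.map_apply (by fun_prop) hE, h]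
  have hmeas : Measurable fun p : (ι → Fin K) × (ι × Fin K → Z) =>
      (fun q => p.2 (rowShift p.1 q) : ι × Fin K → Z) := by
    refine measurable_from_prod_countable_right fun j => ?_
    exact measurable_pi_lambda _ fun q => measurable_pi_apply (rowShift j q)
  have hprod := hmeas hE
  have h1 : ((selection ι K).prod ν) ((fun p : (ι → Fin K) × (ι × Fin K → Z) =>
      (fun q => p.2 (rowShift p.1 q) : ι × Fin K → Z)) ⁻¹' E) = ν E := by
    rw [Measure.prod_apply hprod]
    calc _ = ∫⁻ _ : ι → Fin K, ν E ∂(selection ι K) := lintegral_congr fun j => hshift j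
      _ = ν E := by simp
  rw [← h1, Measure.prod_apply_symm hprod]
  calc _ ≤ ∫⁻ _ : ι × Fin K → Z, (S * ε : ENNReal) ∂ν := by
        refine lintegral_mono fun w => ?_
        have hfin : ((fun C => w ⁻¹' C) '' H).Finite := Set.toFinite _
        have hsub : (fun j => (j, w)) ⁻¹' ((fun p : (ι → Fin K) × (ι × Fin K → Z) =>
            (fun q => p.2 (rowShift p.1 q) : ι × Fin K → Z)) ⁻¹' E)
            ⊆ ⋃ T ∈ hfin.toFinset, {j | sep (hits Finset.univ (fun i => {l | (i, l) ∈ T}) j)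
              (∑ q, T.indicator (fun _ => (1 : ℝ)) q)} := by
          rintro j ⟨C, hC, hj⟩
          simp only [Set.mem_iUnion]
          refine ⟨w ⁻¹' C, by simpa using ⟨C, hC, rfl⟩, ?_⟩
          have e1 : hits Finset.univ (fun i => {l | (i, l) ∈ w ⁻¹' C}) j
              = ∑ i, C.indicator (fun _ => (1 : ℝ)) (w (rowShift j (i, 0))) := by
            simp only [hits, rowShift_apply, zero_add]
            rfl
          have e2 : ∑ q, (w ⁻¹' C).indicator (fun _ => (1 : ℝ)) q
              = ∑ q, C.indicator (fun _ => (1 : ℝ)) (w (rowShift j q)) :=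
            ((rowShift j).sum_comp fun q => C.indicator (fun _ => (1 : ℝ)) (w q)).symm
          simp only [Set.mem_ofPred_eq, e1, e2]
          exact hj
        refine (measure_mono hsub).trans ((measure_biUnion_finset_le _ _).trans ?_)
        refine (Finset.sum_le_sum fun T _ => hsel T).trans ?_
        rw [Finset.sum_const, nsmul_eq_mul]
        gcongr
        rw [← Set.ncard_eq_toFinset_card _ hfin]
        exact hS w
    _ = S * ε := by simp

/-- Symmetrization: a uniform deviation event is controlled by the probability that a random
selection of columns is separated from a fixed array. -/
theorem measure_exists_bad_le (P : Measure Z) [IsProbabilityMeasure P] {H : Set (Set Z)}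
    (hH : H.Countable) (hHm : ∀ C ∈ H, MeasurableSet C) {sep : ℝ → ℝ → Prop}
    (hsep : MeasurableSet {q : ℝ × ℝ | sep q.1 q.2}) {S : ℕ}
    (hS : ∀ w : ι × Fin K → Z, ((fun C => w ⁻¹' C) '' H).ncard ≤ S) {ε : ENNReal}
    (hsel : ∀ T : Set (ι × Fin K), selection ι K
      {j | sep (hits Finset.univ (fun i => {l | (i, l) ∈ T}) j)
        (∑ q, T.indicator (fun _ => (1 : ℝ)) q)} ≤ ε)
    {bad : Set Z → ℝ → Prop}
    (hghost : ∀ C ∈ H, ∀ c, 0 ≤ c → bad C c →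
      Measure.infinitePi (fun _ : {q : ι × Fin K // ¬ q.2 = 0} => P)
        {u | ¬ sep c (c + hits Finset.univ (fun _ => C) u)} ≤ 1 / 2) :
    Measure.infinitePi (fun _ : ι => P)
      {v | ∃ C ∈ H, bad C (hits Finset.univ (fun _ => C) v)} ≤ 2 * (S * ε) := by
  classical
  have hEle := measure_arrayEvent_le (ι := ι) P hH hHm hsep hS hsel
  set E : Set (ι × Fin K → Z) := arrayEvent H sep with hEdef
  have hE : MeasurableSet E := measurableSet_arrayEvent hH hHm hsep
  set p : ι × Fin K → Prop := fun q => q.2 = 0 with hp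
  set ν₀ := Measure.infinitePi fun _ : {q // p q} => P
  set ν₁ := Measure.infinitePi fun _ : {q // ¬ p q} => P
  have hmp := measurePreserving_piEquivPiSubtypeProd (fun _ : ι × Fin K => P) p
  rw [← Measure.infinitePi_eq_pi, ← Measure.infinitePi_eq_pi, ← Measure.infinitePi_eq_pi] at hmp
  have hmp' := hmp.symm
  set e := MeasurableEquiv.piEquivPiSubtypeProd (fun _ : ι × Fin K => Z) p
  have hE' : MeasurableSet (e.symm ⁻¹' E) := e.symm.measurable hE
  have hEeq : Measure.infinitePi (fun _ : ι × Fin K => P) E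
      = ∫⁻ v, ν₁ (Prod.mk v ⁻¹' (e.symm ⁻¹' E)) ∂ν₀ := by
    rw [← Measure.prod_apply hE', ← hmp'.measure_preimage_equiv]
  let col : ι → {q // p q} := fun i => ⟨(i, 0), rfl⟩
  have hcol : Function.Bijective col := by
    refine ⟨fun i i' h => ?_, ?_⟩
    · exact congrArg Prod.fst (congrArg Subtype.val h)
    · rintro ⟨⟨i, l⟩, hl⟩
      exact ⟨i, Subtype.ext (Prod.ext rfl (show (0 : Fin K) = l from (show l = 0 from hl).symm))⟩
  have hlaw := Measure.map_infinitePi_infinitePi_of_inj (P := fun _ : {q // p q} => P)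
    hcol.injective
  have hsecm : Measurable fun v => ν₁ (Prod.mk v ⁻¹' (e.symm ⁻¹' E)) :=
    measurable_measure_prodMk_left hE'
  -- Markov's inequality for the conditional probability of `E` given the first column; `hsub` shows
  -- that a bad first column makes it at least `1/2`.
  have hmk := mul_meas_ge_le_lintegral (μ := ν₀) hsecm (1 / 2)
  have hsub : ∀ v : {q // p q} → Z,
      (∃ C ∈ H, bad C (hits Finset.univ (fun _ => C) fun i => v (col i))) →
      1 / 2 ≤ ν₁ (Prod.mk v ⁻¹' (e.symm ⁻¹' E)) := by
    rintro v ⟨C, hC, hbad⟩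
    have h0 := hghost C hC _ (hits_nonneg _ _ _) hbad
    set G : Set ({q // ¬ p q} → Z) := {u | ¬ sep (hits Finset.univ (fun _ => C) fun i => v (col i))
      (hits Finset.univ (fun _ => C) (fun i => v (col i)) + hits Finset.univ (fun _ => C) u)}
    have hGsub : (Prod.mk v ⁻¹' (e.symm ⁻¹' E))ᶜ ⊆ G := by
      intro u hu hsepu
      apply hu
      have hval : ∀ q, e.symm (v, u) q = if h : p q then v ⟨q, h⟩ else u ⟨q, h⟩ := fun q => rfl
      refine ⟨C, hC, ?_⟩
      have e1 : ∑ i, C.indicator (fun _ => (1 : ℝ)) (e.symm (v, u) (i, 0))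
          = hits Finset.univ (fun _ => C) fun i => v (col i) := rfl
      have e2 : ∑ q, C.indicator (fun _ => (1 : ℝ)) (e.symm (v, u) q)
          = hits Finset.univ (fun _ => C) (fun i => v (col i))
            + hits Finset.univ (fun _ => C) u := by
        rw [← Fintype.sum_subtype_add_sum_subtype p]
        congr 1
        · unfold hits
          rw [← Function.Bijective.sum_comp hcol
            (fun q : {q // p q} => C.indicator (fun _ => (1 : ℝ)) (e.symm (v, u) q))]
          rfl
        · refine Finset.sum_congr rfl fun q _ => ?_
          rw [hval, dif_neg q.2]
      rw [e1, e2]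
      exact hsepu
    have h1 : ν₁ (Prod.mk v ⁻¹' (e.symm ⁻¹' E))ᶜ ≤ 1 / 2 := (measure_mono hGsub).trans h0
    have hsecE : MeasurableSet (Prod.mk v ⁻¹' (e.symm ⁻¹' E)) := measurable_prodMk_left hE'
    rw [prob_compl_eq_one_sub hsecE] at h1
    have h2 := tsub_le_iff_left.1 h1
    have h3 : (1 : ENNReal) = 1 / 2 + 1 / 2 := (ENNReal.add_halves 1).symm
    have h4 : (1 / 2 : ENNReal) + 1 / 2 ≤ ν₁ (Prod.mk v ⁻¹' (e.symm ⁻¹' E)) + 1 / 2 := h3 ▸ h2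
    exact (ENNReal.add_le_add_iff_right (by simp)).1 h4
  -- The bad event itself need not be measurable: it is only compared, as an outer measure, with a
  -- superlevel set of the conditional probability.
  have hle : Measure.infinitePi (fun _ : ι => P)
      {v | ∃ C ∈ H, bad C (hits Finset.univ (fun _ => C) v)}
      ≤ ν₀ {v | 1 / 2 ≤ ν₁ (Prod.mk v ⁻¹' (e.symm ⁻¹' E))} := by
    let c : ({q // p q} → Z) ≃ᵐ (ι → Z) :=
      (MeasurableEquiv.piCongrLeft (fun _ => Z) (Equiv.ofBijective col hcol)).symm
    have hc : ∀ v i, c v i = v (col i) := fun v i => rfl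
    have hlaw' : ν₀.map c = Measure.infinitePi fun _ : ι => P := hlaw
    rw [← hlaw', c.map_apply]
    exact measure_mono fun v hv => hsub v hv
  calc _ ≤ 2 * (1 / 2 * ν₀ {v | 1 / 2 ≤ ν₁ (Prod.mk v ⁻¹' (e.symm ⁻¹' E))}) := by
        rw [← mul_assoc, one_div, ENNReal.mul_inv_cancel two_ne_zero (by simp), one_mul]
        simpa using hle
    _ ≤ 2 * (S * ε) := by
        refine mul_le_mul_right (hmk.trans ?_) 2
        exact hEeq ▸ hEle

end Ghost

/-! ### Relative uniform deviations -/

section Relative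

variable {ι Z : Type*} [Fintype ι] [MeasurableSpace Z]

theorem sum_uniformOn_row (T : Set (ι × Fin 32)) :
    ∑ i, (ProbabilityTheory.uniformOn (Set.univ : Set (Fin 32))).real {l | (i, l) ∈ T}
      = (∑ q, T.indicator (fun _ => (1 : ℝ)) q) / 32 := by
  classical
  rw [Fintype.sum_prod_type, Finset.sum_div]
  refine Finset.sum_congr rfl fun i _ => ?_
  rw [measureReal_def, ProbabilityTheory.uniformOn_univ,
    Measure.count_apply_finite _ (Set.toFinite _), ENNReal.toReal_div]
  simp [Set.indicator_apply, Finset.sum_boole]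

/-- The count `c` of the selected column lies below its mean `T / 32` by a relative margin. -/
def SepLower (A c T : ℝ) : Prop := 0 < T ∧ c ≤ T / 32 - √(A * T / 64)

/-- The count `c` of the selected column lies above its mean `T / 32` by a relative margin. -/
def SepUpper (A c T : ℝ) : Prop := T / 32 + (A / 4 + √(A ^ 2 / 16 + A * T / 64)) ≤ c

theorem measurableSet_sepLower (A : ℝ) : MeasurableSet {q : ℝ × ℝ | SepLower A q.1 q.2} := by
  have h1 : MeasurableSet {q : ℝ × ℝ | 0 < q.2} :=
    measurableSet_lt measurable_const measurable_snd
  have h2 : MeasurableSet {q : ℝ × ℝ | q.1 ≤ q.2 / 32 - √(A * q.2 / 64)} :=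
    measurableSet_le measurable_fst (by fun_prop)
  exact h1.inter h2

theorem measurableSet_sepUpper (A : ℝ) : MeasurableSet {q : ℝ × ℝ | SepUpper A q.1 q.2} :=
  measurableSet_le (by fun_prop) measurable_fst

/-- The margin `x = √(AT/64)` is chosen so that `x² / (2M) = A/4` at the mean `M = T/32`. -/
theorem selection_sepLower_le {A : ℝ} (hA : 0 ≤ A) (T : Set (ι × Fin 32)) :
    selection ι 32 {j | SepLower A (hits Finset.univ (fun i => {l | (i, l) ∈ T}) j)
      (∑ q, T.indicator (fun _ => (1 : ℝ)) q)} ≤ ENNReal.ofReal (Real.exp (-(A / 4))) := by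
  by_cases hT : 0 < ∑ q, T.indicator (fun _ => (1 : ℝ)) q
  · set t := ∑ q, T.indicator (fun _ => (1 : ℝ)) q
    have hrow : _ = t / 32 := sum_uniformOn_row T
    have h := measure_hits_le_le
      (fun _ : ι => ProbabilityTheory.uniformOn (Set.univ : Set (Fin 32))) Finset.univ
      (B := fun i => {l | (i, l) ∈ T}) (fun i => (Set.toFinite _).measurableSet)
      hrow (by positivity) (Real.sqrt_nonneg (A * t / 64))
    refine (measure_mono fun j hj => hj.2).trans (h.trans_eq ?_)
    rw [Real.sq_sqrt (by positivity)]
    congr 3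
    field_simp
    ring
  · have : {j : ι → Fin 32 | SepLower A (hits Finset.univ (fun i => {l | (i, l) ∈ T}) j)
      (∑ q, T.indicator (fun _ => (1 : ℝ)) q)} = ∅ :=
      Set.eq_empty_of_forall_notMem fun j hj => hT hj.1
    rw [this, measure_empty]
    exact zero_le

/-- The margin is the positive root of `x² = (A/2)(M + x)` at the mean `M = T/32`, so the Chernoff
exponent is `A/4`. -/
theorem selection_sepUpper_le {A : ℝ} (hA : 0 < A) (T : Set (ι × Fin 32)) :
    selection ι 32 {j | SepUpper A (hits Finset.univ (fun i => {l | (i, l) ∈ T}) j)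
      (∑ q, T.indicator (fun _ => (1 : ℝ)) q)} ≤ ENNReal.ofReal (Real.exp (-(A / 4))) := by
  set t := ∑ q, T.indicator (fun _ => (1 : ℝ)) q
  have ht : 0 ≤ t := Finset.sum_nonneg fun _ _ => Set.indicator_nonneg (fun _ _ => zero_le_one) _
  have hx0 : 0 ≤ A / 4 + √(A ^ 2 / 16 + A * t / 64) := by positivity
  have h := measure_hits_ge_le
    (fun _ : ι => ProbabilityTheory.uniformOn (Set.univ : Set (Fin 32))) Finset.univ
    (B := fun i => {l | (i, l) ∈ T}) (fun i => (Set.toFinite _).measurableSet)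
    (sum_uniformOn_row T).le hx0
  refine h.trans (ENNReal.ofReal_le_ofReal (Real.exp_le_exp.2 ?_))
  have hs := Real.sq_sqrt (show 0 ≤ A ^ 2 / 16 + A * t / 64 by positivity)
  set s := √(A ^ 2 / 16 + A * t / 64)
  have hs0 : 0 ≤ s := Real.sqrt_nonneg _
  rw [neg_le_neg_iff, le_div_iff₀ (by positivity)]
  nlinarith

/-- With 31 ghost columns the column average `M = (c + Y)/32` stays close to the expected count `P`.
The gap between the constant `4/5` in the hypothesis and the `1/√2` needed for separation pays for
the `1/32` share of `c` and for the ghost fluctuation, which is small against `√(AP)` because `A ≥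
32`. -/
theorem sepLower_of_deviation {A P c Y : ℝ} (hA : 32 ≤ A) (hP : 0 ≤ P) (hc : 0 ≤ c)
    (hdev : 4 / 5 * √(A * P) < P - c) (hY : 31 * P - √(62 * P) < Y) :
    SepLower A c (c + Y) := by
  obtain ⟨a, ha0, rfl⟩ : ∃ a : ℝ, 0 ≤ a ∧ A = a ^ 2 :=
    ⟨√A, Real.sqrt_nonneg _, (Real.sq_sqrt (by linarith)).symm⟩
  obtain ⟨q, hq0, rfl⟩ : ∃ q : ℝ, 0 ≤ q ∧ P = q ^ 2 :=
    ⟨√P, Real.sqrt_nonneg _, (Real.sq_sqrt hP).symm⟩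
  have ha : 56 / 10 ≤ a := by nlinarith
  rw [← mul_pow, Real.sqrt_sq (by positivity)] at hdev
  have h62 : √(62 * q ^ 2) ≤ 788 / 100 * q := by
    rw [Real.sqrt_le_iff]
    exact ⟨by positivity, by nlinarith⟩
  have hq : 0 < q := by
    rcases hq0.eq_or_lt with h | h
    · subst h; norm_num at hdev; linarith
    · exact h
  have hqa : 4 / 5 * a < q := by
    by_contra hcon
    push Not at hcon
    nlinarith
  set M := (c + Y) / 32 with hM
  have hMlow : q ^ 2 - (q ^ 2 - c) / 32 - 247 / 1000 * q ≤ M := by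
    rw [hM]; linarith
  have hM0 : 0 < M := by nlinarith
  refine ⟨by linarith, ?_⟩
  -- Slope of the tangent to `√(AM/2)` at `M = q²`, with `70711/100000` an upper bound for `1/√2`;
  -- the root is thereby replaced by a linear term.
  set b : ℝ := a * (70711 / 100000) / (2 * q) with hb
  have hbq : b * (2 * q) = a * (70711 / 100000) := by rw [hb]; field_simp
  have hb0 : 0 ≤ b := by positivity
  have hb1 : b ≤ 1 := by
    rw [hb, div_le_one (by positivity)]; linarith
  have hsq : √(a ^ 2 * (c + Y) / 64) ≤ b * (M + q ^ 2) := by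
    rw [Real.sqrt_le_iff]
    refine ⟨by positivity, ?_⟩
    have e1 : a ^ 2 * (c + Y) / 64 = a ^ 2 * M / 2 := by rw [hM]; ring
    have e2 : (b * (M + q ^ 2)) ^ 2
        = (a * (70711 / 100000)) ^ 2 * ((M + q ^ 2) ^ 2 / (4 * q ^ 2)) := by
      rw [hb]; field_simp; norm_num
    have e3 : M ≤ (M + q ^ 2) ^ 2 / (4 * q ^ 2) := by
      rw [le_div_iff₀ (by positivity)]
      nlinarith [sq_nonneg (M - q ^ 2)]
    rw [e1, e2]
    calc a ^ 2 * M / 2 ≤ (a * (70711 / 100000)) ^ 2 * M := by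
          nlinarith [mul_nonneg (sq_nonneg a) hM0.le]
      _ ≤ _ := by gcongr
  have h1 : (q ^ 2 - (q ^ 2 - c) / 32 - 247 / 1000 * q) * (1 - b) ≤ M * (1 - b) :=
    mul_le_mul_of_nonneg_right hMlow (by linarith)
  have h2 : 0 ≤ b * ((q ^ 2 - c) / 32 + 247 / 1000 * q) := by
    apply mul_nonneg hb0
    nlinarith [mul_nonneg ha0 hq0]
  have h3 : b * q ^ 2 * 2 = a * q * (70711 / 100000) := by linear_combination q * hbq
  have h4 : 56 / 10 * q ≤ a * q := mul_le_mul_of_nonneg_right ha hq0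
  nlinarith

/-- With `u = c - P`, the hypothesis gives `A c ≤ u²`. The ghost columns cost at most a tenth of
`u`, so `s = c - M ≥ 9u/10` and `s² ≥ A c / 2`, which is the squared form of the separation. -/
theorem sepUpper_of_deviation {A P c Y : ℝ} (hA : 32 ≤ A) (hP : 0 ≤ P)
    (hdev : P + A + √(A * P) < c) (hY : Y < 31 * P + (√(62 * P) + 2)) :
    SepUpper A c (c + Y) := by
  obtain ⟨a, ha0, rfl⟩ : ∃ a : ℝ, 0 ≤ a ∧ A = a ^ 2 :=
    ⟨√A, Real.sqrt_nonneg _, (Real.sq_sqrt (by linarith)).symm⟩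
  obtain ⟨q, hq0, rfl⟩ : ∃ q : ℝ, 0 ≤ q ∧ P = q ^ 2 :=
    ⟨√P, Real.sqrt_nonneg _, (Real.sq_sqrt hP).symm⟩
  have ha : 56 / 10 ≤ a := by nlinarith
  rw [← mul_pow, Real.sqrt_sq (by positivity)] at hdev
  have h62 : √(62 * q ^ 2) ≤ 788 / 100 * q := by
    rw [Real.sqrt_le_iff]
    exact ⟨by positivity, by nlinarith⟩
  set u := c - q ^ 2 with hu
  have hul : a ^ 2 + a * q < u := by linarith
  have haq : 56 / 10 * q ≤ a * q := mul_le_mul_of_nonneg_right ha hq0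
  set M := (c + Y) / 32 with hM
  have hMc : M ≤ c - 9 / 10 * u := by
    have : 32 * M ≤ c + 31 * q ^ 2 + 788 / 100 * q + 2 := by rw [hM]; linarith
    linarith
  set s := c - M with hs
  have hs1 : 9 / 10 * u ≤ s := by linarith
  have hu2 : a ^ 2 * c ≤ u ^ 2 := by
    have : a ^ 2 * c = a ^ 2 * u + (a * q) ^ 2 := by rw [hu]; ring
    have h1 : a * q * (a * q) ≤ u * (a * q) :=
      mul_le_mul_of_nonneg_right (by nlinarith) (by positivity)
    have h2 : (a ^ 2 + a * q) * u ≤ u * u := mul_le_mul_of_nonneg_right hul.le (by nlinarith)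
    nlinarith
  have hs2 : a ^ 2 / 2 * c ≤ s ^ 2 := by
    have : (9 / 10 * u) ^ 2 ≤ s ^ 2 := pow_le_pow_left₀ (by nlinarith) hs1 2
    nlinarith
  have hkey : √((a ^ 2) ^ 2 / 16 + a ^ 2 * (c + Y) / 64) ≤ s - a ^ 2 / 4 := by
    rw [Real.sqrt_le_iff]
    refine ⟨by nlinarith, ?_⟩
    have e1 : a ^ 2 * (c + Y) / 64 = a ^ 2 * (c - s) / 2 := by rw [hs, hM]; ring
    rw [e1]
    nlinarith
  unfold SepUpper
  have : (c + Y) / 32 = c - s := by rw [hs]; ring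
  linarith

theorem sum_ghost_const (p : ℝ) :
    ∑ _q : {q : ι × Fin 32 // ¬ q.2 = 0}, p = 31 * (Fintype.card ι * p) := by
  classical
  have h := Fintype.sum_subtype_add_sum_subtype (fun q : ι × Fin 32 => q.2 = 0) fun _ => p
  have h0 : Fintype.card {q : ι × Fin 32 // q.2 = 0} = Fintype.card ι :=
    Fintype.card_congr
      { toFun := fun q => q.1.1
        invFun := fun i => ⟨(i, 0), rfl⟩
        left_inv := fun q => Subtype.ext (Prod.ext rfl q.2.symm)
        right_inv := fun i => rfl }
  simp only [Finset.sum_const, Finset.card_univ, nsmul_eq_mul, Fintype.card_prod, Fintype.card_fin,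
    h0, Nat.cast_mul] at h ⊢
  push_cast at h
  linarith

variable (P : Measure Z) [IsProbabilityMeasure P] {H : Set (Set Z)}

/-- Uniform relative deviation of empirical frequencies below probabilities. -/
theorem measure_exists_lower_deviation_le (hH : H.Countable) (hHm : ∀ C ∈ H, MeasurableSet C)
    {S : ℕ} (hS : ∀ w : ι × Fin 32 → Z, ((fun C => w ⁻¹' C) '' H).ncard ≤ S) {A : ℝ}
    (hA : 32 ≤ A) :
    Measure.infinitePi (fun _ : ι => P)
      {v | ∃ C ∈ H, 4 / 5 * √(A * (Fintype.card ι * P.real C))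
        < Fintype.card ι * P.real C - hits Finset.univ (fun _ => C) v}
      ≤ 2 * (S * ENNReal.ofReal (Real.exp (-(A / 4)))) := by
  refine measure_exists_bad_le (K := 32) P hH hHm (measurableSet_sepLower A) hS
    (selection_sepLower_le (by linarith))
    (bad := fun C c => 4 / 5 * √(A * (Fintype.card ι * P.real C))
        < Fintype.card ι * P.real C - c) fun C hC c hc hbad => ?_
  set p : ℝ := Fintype.card ι * P.real C with hp
  have hp0 : 0 < p := by
    have := Real.sqrt_nonneg (A * p)
    linarith
  have hsum : ∑ _q : {q : ι × Fin 32 // ¬ q.2 = 0}, P.real C = 31 * p := sum_ghost_const _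
  have h := measure_hits_le_le (fun _ : {q : ι × Fin 32 // ¬ q.2 = 0} => P) Finset.univ
    (B := fun _ => C) (fun _ => hHm C hC) hsum (by positivity) (Real.sqrt_nonneg (62 * p))
  refine (measure_mono fun u hu => ?_).trans (h.trans ?_)
  · by_contra hcon
    exact hu (sepLower_of_deviation hA hp0.le hc hbad (not_le.1 hcon))
  -- The ghost mean is `31p`, so a drop of `√(62p)` has Chernoff exponent `1`, and `e⁻¹ ≤ 1/2`.
  · rw [Real.sq_sqrt (by positivity), show 2 * (31 * p) = 62 * p by ring,
      div_self (by positivity), show (1 / 2 : ENNReal) = ENNReal.ofReal (1 / 2) by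
        rw [ENNReal.ofReal_div_of_pos two_pos]; simp]
    apply ENNReal.ofReal_le_ofReal
    rw [Real.exp_neg, one_div]
    exact inv_anti₀ two_pos (by have := Real.exp_one_gt_d9; linarith)

/-- Uniform relative deviation of empirical frequencies above probabilities. -/
theorem measure_exists_upper_deviation_le (hH : H.Countable) (hHm : ∀ C ∈ H, MeasurableSet C)
    {S : ℕ} (hS : ∀ w : ι × Fin 32 → Z, ((fun C => w ⁻¹' C) '' H).ncard ≤ S) {A : ℝ}
    (hA : 32 ≤ A) :
    Measure.infinitePi (fun _ : ι => P)
      {v | ∃ C ∈ H, Fintype.card ι * P.real C + A + √(A * (Fintype.card ι * P.real C))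
        < hits Finset.univ (fun _ => C) v}
      ≤ 2 * (S * ENNReal.ofReal (Real.exp (-(A / 4)))) := by
  refine measure_exists_bad_le (K := 32) P hH hHm (measurableSet_sepUpper A) hS
    (selection_sepUpper_le (by linarith))
    (bad := fun C c => Fintype.card ι * P.real C + A + √(A * (Fintype.card ι * P.real C)) < c)
    fun C hC c hc hbad => ?_
  set p : ℝ := Fintype.card ι * P.real C with hp
  have hp0 : 0 ≤ p := by positivity
  have hsum : ∑ _q : {q : ι × Fin 32 // ¬ q.2 = 0}, P.real C = 31 * p := sum_ghost_const _
  have h := measure_hits_ge_le (fun _ : {q : ι × Fin 32 // ¬ q.2 = 0} => P) Finset.univ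
    (B := fun _ => C) (fun _ => hHm C hC) hsum.le (x := √(62 * p) + 2) (by positivity)
  refine (measure_mono fun u hu => ?_).trans (h.trans ?_)
  · by_contra hcon
    exact hu (sepUpper_of_deviation hA hp0 hbad (not_le.1 hcon))
  · rw [show (1 / 2 : ENNReal) = ENNReal.ofReal (1 / 2) by
        rw [ENNReal.ofReal_div_of_pos two_pos]; simp]
    apply ENNReal.ofReal_le_ofReal
    have hs := Real.sq_sqrt (show 0 ≤ 62 * p by positivity)
    have hs0 := Real.sqrt_nonneg (62 * p)
    set s := √(62 * p)
    rw [show (1 / 2 : ℝ) = Real.exp (-Real.log 2) by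
      rw [Real.exp_neg, Real.exp_log two_pos, one_div]]
    apply Real.exp_le_exp.2
    rw [neg_le_neg_iff, le_div_iff₀ (by positivity)]
    have hl := Real.log_two_lt_d9
    have hl0 := Real.log_pos one_lt_two
    have : Real.log 2 * (2 * (31 * p + (s + 2))) ≤ 7 / 10 * (2 * (31 * p + (s + 2))) :=
      mul_le_mul_of_nonneg_right (by linarith) (by positivity)
    nlinarith

end Relative

/-! ### Uniform deviations over a hypothesis class -/

section Class

variable {X : Type*}

/-- The examples in `D` on which `f` and `g` disagree. -/
def disagreeOn (g : X → Bool) (D : Set (X × Bool)) (f : X → Bool) : Set (X × Bool) :=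
  {z | f z.1 ≠ g z.1 ∧ z ∈ D}

/-- For fixed `g` and `D`, the trace of `disagreeOn g D f` is a function of the trace of `f`. -/
theorem ncard_disagreeOn_trace_le {F F₀ : Set (X → Bool)} (hsub : F₀ ⊆ F) {d : ℕ}
    (hF : ∀ S : Finset X, Shatters F S → S.card ≤ d) (g : X → Bool) (D : Set (X × Bool))
    {J : Type*} [Fintype J] (w : J → X × Bool) :
    ((fun C => w ⁻¹' C) '' (disagreeOn g D '' F₀)).ncard
      ≤ ∑ k ∈ Finset.Iic d, (Fintype.card J).choose k := by
  classical
  refine le_trans ?_ (ncard_trace_le hF fun j => (w j).1)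
  have himg : (fun C => w ⁻¹' C) '' (disagreeOn g D '' F₀) ⊆
      (fun c : J → Bool => {j | c j ≠ g (w j).1 ∧ w j ∈ D}) ''
        ((fun f : X → Bool => f ∘ fun j => (w j).1) '' F) := by
    rintro _ ⟨_, ⟨f, hf, rfl⟩, rfl⟩
    exact ⟨_, ⟨f, hsub hf, rfl⟩, rfl⟩
  exact (Set.ncard_le_ncard himg (Set.toFinite _)).trans (Set.ncard_image_le (Set.toFinite _))

variable [MeasurableSpace X]

theorem measurableSet_disagreeOn {f g : X → Bool} (hf : Measurable f) (hg : Measurable g)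
    {D : Set (X × Bool)} (hD : MeasurableSet D) : MeasurableSet (disagreeOn g D f) :=
  ((measurableSet_eq_fun (hf.comp measurable_fst) (hg.comp measurable_fst)).compl).inter hD

/-- Labels are discrete, so along the sequence the values at the finitely many sample points are
eventually those of `f`, while the probability converges. A strict deviation is an open condition on
the probability, hence passes from `f` to a member of the countable subclass. -/
theorem exists_approx {F₀ : Set (X → Bool)} (P : Measure (X × Bool)) [IsProbabilityMeasure P]
    {g : X → Bool} (hg : Measurable g) {D : Set (X × Bool)} (hD : MeasurableSet D)
    {f : X → Bool} {u : ℕ → X → Bool} (hu : ∀ n, u n ∈ F₀)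
    (hum : ∀ n, Measurable (u n)) (hlim : ∀ x, Tendsto (fun n => u n x) atTop (𝓝 (f x)))
    {ι : Type*} [Fintype ι] (v : ι → X × Bool) {s : Set ℝ} (hs : IsOpen s)
    (hmem : P.real (disagreeOn g D f) ∈ s) :
    ∃ f₀ ∈ F₀, P.real (disagreeOn g D f₀) ∈ s ∧
      hits Finset.univ (fun _ => disagreeOn g D f₀) v
        = hits Finset.univ (fun _ => disagreeOn g D f) v := by
  have hev : ∀ x, ∀ᶠ n in atTop, u n x = f x := fun x => by
    simpa [nhds_discrete] using hlim x
  have hmeas : Tendsto (fun n => P.real (disagreeOn g D (u n))) atTop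
      (𝓝 (P.real (disagreeOn g D f))) := by
    refine (ENNReal.tendsto_toReal (measure_ne_top _ _)).comp ?_
    refine tendsto_measure_of_tendsto_indicator_of_isFiniteMeasure atTop P
      (fun n => measurableSet_disagreeOn (hum n) hg hD) fun z => ?_
    filter_upwards [hev z.1] with n hn
    simp [disagreeOn, hn]
  have h1 := hmeas.eventually (hs.mem_nhds hmem)
  have h2 : ∀ᶠ n in atTop, ∀ i, u n (v i).1 = f (v i).1 := eventually_all.2 fun i => hev _
  obtain ⟨n, hn1, hn2⟩ := (h1.and h2).exists
  refine ⟨u n, hu n, hn1, ?_⟩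
  unfold hits
  refine Finset.sum_congr rfl fun i _ => ?_
  have hiff : v i ∈ disagreeOn g D (u n) ↔ v i ∈ disagreeOn g D f := by simp [disagreeOn, hn2 i]
  by_cases hi : v i ∈ disagreeOn g D f
  · rw [Set.indicator_of_mem hi, Set.indicator_of_mem (hiff.2 hi)]
  · rw [Set.indicator_of_notMem hi, Set.indicator_of_notMem (mt hiff.1 hi)]

variable (P : Measure (X × Bool)) [IsProbabilityMeasure P] {F : Set (X → Bool)} {d n : ℕ}

theorem growth_mul_exp_le (hd : 1 ≤ d) (hdn : d ≤ n) (A : ℝ) :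
    (2 : ENNReal) * (((∑ k ∈ Finset.Iic d, (Fintype.card (Fin n × Fin 32)).choose k : ℕ) : ENNReal)
        * ENNReal.ofReal (Real.exp (-(A / 4))))
      ≤ ENNReal.ofReal (2 * ((Real.exp 1 * (n * 32) / d) ^ d * Real.exp (-(A / 4)))) := by
  have hg := sum_choose_le_pow (N := Fintype.card (Fin n × Fin 32)) hd
    (by simp only [Fintype.card_prod, Fintype.card_fin]; omega)
  rw [ENNReal.ofReal_mul zero_le_two, ENNReal.ofReal_mul (by positivity), ENNReal.ofReal_ofNat]
  refine mul_le_mul_right (mul_le_mul_left ?_ _) _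
  rw [← ENNReal.ofReal_natCast]
  apply ENNReal.ofReal_le_ofReal
  simpa using hg

/-- Uniform lower deviations for the sets `disagreeOn g D f`, `f ∈ F`. -/
theorem measure_class_lower_deviation_le (hF : PointwiseMeasurable F)
    (hvc : ∀ S : Finset X, Shatters F S → S.card ≤ d) (hd : 1 ≤ d) (hdn : d ≤ n)
    {g : X → Bool} (hg : Measurable g) {D : Set (X × Bool)} (hD : MeasurableSet D) {A : ℝ}
    (hA : 32 ≤ A) :
    Measure.infinitePi (fun _ : Fin n => P)
      {v | ∃ f ∈ F, 4 / 5 * √(A * (n * P.real (disagreeOn g D f)))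
        < n * P.real (disagreeOn g D f) - hits Finset.univ (fun _ => disagreeOn g D f) v}
      ≤ ENNReal.ofReal (2 * ((Real.exp 1 * (n * 32) / d) ^ d * Real.exp (-(A / 4)))) := by
  obtain ⟨hFm, F₀, hsub, hcount, happ⟩ := hF
  refine le_trans (measure_mono ?_) ((measure_exists_lower_deviation_le (ι := Fin n) P
    (hcount.image (disagreeOn g D)) ?_ (ncard_disagreeOn_trace_le hsub hvc g D) hA).trans
      (growth_mul_exp_le hd hdn A))
  · rintro v ⟨f, hf, hbad⟩
    obtain ⟨u, hu, hlim⟩ := happ f hf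
    have hopen : IsOpen {p : ℝ | 4 / 5 * √(A * (n * p))
        < n * p - hits Finset.univ (fun _ => disagreeOn g D f) v} :=
      isOpen_lt (by fun_prop) (by fun_prop)
    obtain ⟨f₀, hf₀, h1, h2⟩ := exists_approx P hg hD hu
      (fun n => hFm _ (hsub (hu n))) hlim v hopen hbad
    refine ⟨_, ⟨f₀, hf₀, rfl⟩, ?_⟩
    rw [h2, Fintype.card_fin]
    exact h1
  · rintro _ ⟨f, hf, rfl⟩
    exact measurableSet_disagreeOn (hFm f (hsub hf)) hg hD

/-- Uniform upper deviations for the sets `disagreeOn g D f`, `f ∈ F`. -/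
theorem measure_class_upper_deviation_le (hF : PointwiseMeasurable F)
    (hvc : ∀ S : Finset X, Shatters F S → S.card ≤ d) (hd : 1 ≤ d) (hdn : d ≤ n)
    {g : X → Bool} (hg : Measurable g) {D : Set (X × Bool)} (hD : MeasurableSet D) {A : ℝ}
    (hA : 32 ≤ A) :
    Measure.infinitePi (fun _ : Fin n => P)
      {v | ∃ f ∈ F, n * P.real (disagreeOn g D f) + A + √(A * (n * P.real (disagreeOn g D f)))
        < hits Finset.univ (fun _ => disagreeOn g D f) v}
      ≤ ENNReal.ofReal (2 * ((Real.exp 1 * (n * 32) / d) ^ d * Real.exp (-(A / 4)))) := by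
  obtain ⟨hFm, F₀, hsub, hcount, happ⟩ := hF
  refine le_trans (measure_mono ?_) ((measure_exists_upper_deviation_le (ι := Fin n) P
    (hcount.image (disagreeOn g D)) ?_ (ncard_disagreeOn_trace_le hsub hvc g D) hA).trans
      (growth_mul_exp_le hd hdn A))
  · rintro v ⟨f, hf, hbad⟩
    obtain ⟨u, hu, hlim⟩ := happ f hf
    have hopen : IsOpen {p : ℝ | n * p + A + √(A * (n * p))
        < hits Finset.univ (fun _ => disagreeOn g D f) v} :=
      isOpen_lt (by fun_prop) (by fun_prop)
    obtain ⟨f₀, hf₀, h1, h2⟩ := exists_approx P hg hD hu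
      (fun n => hFm _ (hsub (hu n))) hlim v hopen hbad
    refine ⟨_, ⟨f₀, hf₀, rfl⟩, ?_⟩
    rw [h2, Fintype.card_fin]
    exact h1
  · rintro _ ⟨f, hf, rfl⟩
    exact measurableSet_disagreeOn (hFm f (hsub hf)) hg hD

end Class

/-! ### One stage of the algorithm on a good sample -/

section Numeric

theorem sqrt_mul_le_tangent {a x τ : ℝ} (ha : 0 ≤ a) (hx : 0 ≤ x) (hτ : 0 < τ) :
    √(a * x) ≤ (τ * a + x / τ) / 2 := by
  rw [Real.sqrt_le_iff]
  refine ⟨by positivity, ?_⟩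
  have h : τ * a * (x / τ) = a * x := by field_simp
  nlinarith [sq_nonneg (τ * a - x / τ)]

/-- Solves the quadratic inequality for `√p`, turning a slack in the true probability into one in
the empirical frequency. -/
theorem le_of_sub_le_sqrt {a b p : ℝ} (ha : 0 ≤ a) (hb : 0 ≤ b) (hp : 0 ≤ p)
    (h : p - b ≤ √(a * p)) : p ≤ b + (a + √(a * b)) := by
  by_contra hcon
  push Not at hcon
  have hs := Real.sq_sqrt (mul_nonneg ha hb)
  have hs0 := Real.sqrt_nonneg (a * b)
  have hs' := Real.sq_sqrt (mul_nonneg ha hp)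
  have hD : 0 ≤ p - b := by linarith
  have h1 : (p - b) ^ 2 ≤ a * p := by rw [← hs']; exact pow_le_pow_left₀ hD h 2
  nlinarith

/-- The radius of the low-error set in terms of the relative slack. -/
def radius (a ρ : ℝ) : ℝ := (a + √(a * ρ)) + (a + √(a * (ρ + (a + √(a * ρ)))))

theorem radius_mono {a ρ ρ' : ℝ} (ha : 0 ≤ a) (h : ρ ≤ ρ') : radius a ρ ≤ radius a ρ' := by
  unfold radius
  have h1 : √(a * ρ) ≤ √(a * ρ') := Real.sqrt_le_sqrt (mul_le_mul_of_nonneg_left h ha)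
  have h2 : √(a * (ρ + (a + √(a * ρ)))) ≤ √(a * (ρ' + (a + √(a * ρ')))) :=
    Real.sqrt_le_sqrt (mul_le_mul_of_nonneg_left (by linarith) ha)
  linarith

/-- Each root is replaced by a tangent line, after which the claim is linear. The touching points
`τ` are tuned so that the coefficients of `R` and `a` stay below `5` and `7`. -/
theorem add_le_five_mul_add {a R ρ b p : ℝ} (ha : 0 ≤ a) (hR : 0 ≤ R) (hρ0 : 0 ≤ ρ) (hp : 0 ≤ p)
    (hρ : ρ ≤ R + (a / 4 + √(a ^ 2 / 16 + a * R / 2))) (hb : b ≤ ρ + radius a ρ)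
    (hpb : p - b ≤ 4 / 5 * √(a * p)) : R + p ≤ 5 * R + 7 * a := by
  have h1 := sqrt_mul_le_tangent (x := a / 16 + R / 2) ha (by positivity)
    (show (0 : ℝ) < 2 / 5 by norm_num)
  rw [show a * (a / 16 + R / 2) = a ^ 2 / 16 + a * R / 2 by ring] at h1
  have h2 := sqrt_mul_le_tangent ha hρ0 (show (0 : ℝ) < 23 / 25 by norm_num)
  have h3 := sqrt_mul_le_tangent (x := ρ + (a + √(a * ρ))) ha (by positivity)
    (show (0 : ℝ) < 5 / 3 by norm_num)
  have h4 := sqrt_mul_le_tangent ha hp (show (0 : ℝ) < 277 / 100 by norm_num)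
  unfold radius at hb
  linarith

end Numeric

/-! ### Pseudo-labels and survival of the risk minimizer. -/

section Stage

variable {X : Type*}

open Classical in
/-- The example `z` as labelled by the algorithm when the low-error set is `G`. -/
def pseudoLabelled (G : Set (X → Bool)) (z : X × Bool) : X × Bool :=
  (z.1, if z.1 ∈ AGR G then commonLabel G z.1 else z.2)

/-- The sample collected from `k` consecutive examples, starting after the first `n`. -/
def pseudoSample (G : Set (X → Bool)) (z : ℕ → X × Bool) (n k : ℕ) : List (X × Bool) :=
  ((List.range k).map fun l => pseudoLabelled G (z (n + l))).reverse

theorem pseudoSample_succ (G : Set (X → Bool)) (z : ℕ → X × Bool) (n k : ℕ) :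
    pseudoSample G z n (k + 1) = pseudoLabelled G (z (n + k)) :: pseudoSample G z n k := by
  simp [pseudoSample, List.range_succ]

theorem empRisk_pseudoSample (G : Set (X → Bool)) (z : ℕ → X × Bool) (n k : ℕ) (f : X → Bool) :
    empRisk f (pseudoSample G z n k) = (∑ l : Fin k,
      Set.indicator {x : X × Bool | f x.1 ≠ (pseudoLabelled G x).2} (fun _ => (1 : ℝ))
        (z (n + l))) / k := by
  have hlen : (pseudoSample G z n k).length = k := by simp [pseudoSample]
  rw [empRisk, hlen]
  congr 1
  rw [Fin.sum_univ_eq_sum_range (fun l => Set.indicator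
    {x : X × Bool | f x.1 ≠ (pseudoLabelled G x).2} (fun _ => (1 : ℝ)) (z (n + l)))]
  clear hlen
  induction k with
  | zero => simp [pseudoSample]
  | succ k ih =>
    rw [pseudoSample_succ, List.countP_cons, Finset.sum_range_succ, ← ih]
    by_cases h : f (z (n + k)).1 = (pseudoLabelled G (z (n + k))).2
    · rw [Set.indicator_of_notMem (by simpa using h)]
      simp [pseudoLabelled] at h ⊢
      exact h
    · rw [Set.indicator_of_mem (by simpa using h)]
      have : (pseudoLabelled G (z (n + k))).1 = (z (n + k)).1 := rfl
      simp [this, h]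

theorem empRisk_nonneg (f : X → Bool) (S : List (X × Bool)) : 0 ≤ empRisk f S := by
  unfold empRisk; positivity

theorem empRisk_le_one (f : X → Bool) (S : List (X × Bool)) : empRisk f S ≤ 1 := by
  unfold empRisk
  exact div_le_one_of_le₀ (by exact_mod_cast List.countP_le_length) (Nat.cast_nonneg _)

/-- The examples misclassified by `g`. -/
def errorSet (g : X → Bool) : Set (X × Bool) := {z | g z.1 ≠ z.2}

theorem pseudoLabelled_snd {G : Set (X → Bool)} {g : X → Bool} (hg : g ∈ G) (z : X × Bool) :
    (pseudoLabelled G z).2 = g z.1 ∨ (pseudoLabelled G z).2 = z.2 := by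
  classical
  unfold pseudoLabelled
  by_cases h : z.1 ∈ AGR G
  · left; simp [h, commonLabel_eq h hg]
  · right; simp [h]

section Pointwise

variable {G : Set (X → Bool)} {g : X → Bool}

open Classical in
theorem indicator_setOf {α : Type*} (p : α → Prop) (z : α) :
    Set.indicator {x | p x} (fun _ => (1 : ℝ)) z = if p z then 1 else 0 := by
  by_cases h : p z <;> simp [h]

/-- Equality holds when the pseudo-label is the true one. When it is the label of `g`, the left side
is minus the indicator of `{f ≠ g}`, the least possible value. -/
theorem indicator_excess_le (hg : g ∈ G) (f : X → Bool) (z : X × Bool) :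
    Set.indicator {x : X × Bool | g x.1 ≠ (pseudoLabelled G x).2} (fun _ => (1 : ℝ)) z
      - Set.indicator {x : X × Bool | f x.1 ≠ (pseudoLabelled G x).2} (fun _ => (1 : ℝ)) z
      ≤ (disagreeOn g (errorSet g) f).indicator (fun _ => (1 : ℝ)) z
        - (disagreeOn g (errorSet g)ᶜ f).indicator (fun _ => (1 : ℝ)) z := by
  simp only [disagreeOn, errorSet, indicator_setOf, Set.mem_ofPred_eq, Set.mem_compl_iff]
  rcases pseudoLabelled_snd hg z with h | h <;> rw [h] <;> cases f z.1 <;> cases g z.1 <;>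
    cases z.2 <;> norm_num

/-- Where `g` is right, both possible pseudo-labels equal the label of `g`, so a disagreeing `f` is
counted as an error. -/
theorem indicator_disagreeOn_compl_le (hg : g ∈ G) (f : X → Bool) (z : X × Bool) :
    (disagreeOn g (errorSet g)ᶜ f).indicator (fun _ => (1 : ℝ)) z
      ≤ Set.indicator {x : X × Bool | f x.1 ≠ (pseudoLabelled G x).2} (fun _ => (1 : ℝ)) z := by
  simp only [disagreeOn, errorSet, indicator_setOf, Set.mem_ofPred_eq, Set.mem_compl_iff]
  rcases pseudoLabelled_snd hg z with h | h <;> rw [h] <;> cases f z.1 <;> cases g z.1 <;>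
    cases z.2 <;> norm_num

theorem indicator_pseudo_error_le (hg : g ∈ G) (z : X × Bool) :
    Set.indicator {x : X × Bool | g x.1 ≠ (pseudoLabelled G x).2} (fun _ => (1 : ℝ)) z
      ≤ (errorSet g).indicator (fun _ => (1 : ℝ)) z := by
  simp only [errorSet, indicator_setOf]
  rcases pseudoLabelled_snd hg z with h | h
  · rw [h]; split_ifs <;> simp_all
  · rw [h]

end Pointwise

variable [MeasurableSpace X]

/-- The sample `v` satisfies the deviation bounds with relative slack `a`. -/
structure GoodSample (P : Measure (X × Bool)) (F : Set (X → Bool)) (g : X → Bool) (a : ℝ) {n : ℕ}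
    (v : Fin n → X × Bool) : Prop where
  lower : ∀ f ∈ F, P.real (disagreeOn g (errorSet g)ᶜ f)
    - hits Finset.univ (fun _ => disagreeOn g (errorSet g)ᶜ f) v / n
      ≤ 4 / 5 * √(a * P.real (disagreeOn g (errorSet g)ᶜ f))
  upper : ∀ f ∈ F, hits Finset.univ (fun _ => disagreeOn g (errorSet g) f) v / n
    ≤ P.real (disagreeOn g (errorSet g) f)
      + (a + √(a * P.real (disagreeOn g (errorSet g) f)))
  best : hits Finset.univ (fun _ => errorSet g) v / n
    ≤ risk P g + (a / 4 + √(a ^ 2 / 16 + a * risk P g / 2))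

variable {P : Measure (X × Bool)} [IsProbabilityMeasure P] {F : Set (X → Bool)} {g : X → Bool}

theorem measurableSet_errorSet (hg : Measurable g) : MeasurableSet (errorSet g) :=
  (measurableSet_eq_fun (hg.comp measurable_fst) measurable_snd).compl

/-- `f` and `g` share their errors outside `{f ≠ g}`, so the difference of the two sides is `risk P
g - risk P f ≤ 0`. -/
theorem real_disagreeOn_le (hgm : Measurable g) (hmin : IsRiskMinimizer P F g) {f : X → Bool}
    (hf : f ∈ F) (hfm : Measurable f) :
    P.real (disagreeOn g (errorSet g) f) ≤ P.real (disagreeOn g (errorSet g)ᶜ f) := by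
  have hE := measurableSet_errorSet hgm
  have hD := measurableSet_disagreeOn hfm hgm hE
  set B : Set (X × Bool) := errorSet g \ disagreeOn g (errorSet g) f with hB
  have h1 : risk P g = P.real (disagreeOn g (errorSet g) f) + P.real B := by
    rw [← measureReal_union Set.disjoint_sdiff_right (hE.diff hD),
      Set.union_sdiff_cancel fun z hz => hz.2]
    rfl
  have h2 : risk P f = P.real (disagreeOn g (errorSet g)ᶜ f) + P.real B := by
    have hdisj : Disjoint (disagreeOn g (errorSet g)ᶜ f) B :=
      Set.disjoint_left.2 fun z hz hz' => hz.2 hz'.1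
    rw [← measureReal_union hdisj (hE.diff hD)]
    unfold risk
    congr 1
    ext z
    simp only [hB, disagreeOn, errorSet, Set.mem_ofPred_eq, Set.mem_union, Set.mem_sdiff,
      Set.mem_compl_iff]
    cases f z.1 <;> cases g z.1 <;> cases z.2 <;> simp
  have := hmin.2 f hf
  linarith

theorem real_fst_disagree_le (hgm : Measurable g) {f : X → Bool} (hfm : Measurable f) :
    P.fst.real {x | f x ≠ g x} ≤ risk P g + P.real (disagreeOn g (errorSet g)ᶜ f) := by
  have hm : MeasurableSet {x | f x ≠ g x} := (measurableSet_eq_fun hfm hgm).compl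
  rw [measureReal_def, Measure.fst_apply hm, ← measureReal_def]
  refine (measureReal_mono ?_).trans (measureReal_union_le (errorSet g) _)
  intro z hz
  by_cases h : z ∈ errorSet g
  · exact Or.inl h
  · exact Or.inr ⟨hz, h⟩

/-- On a good sample a stage keeps the true risk minimizer and yields a small low-error set. -/
theorem GoodSample.stage (hFm : ∀ f ∈ F, Measurable f) (hmin : IsRiskMinimizer P F g) {a : ℝ}
    (ha : 0 ≤ a) {n : ℕ} (hn : 0 < n) {z : ℕ → X × Bool} {s : ℕ}
    (hgood : GoodSample P F g a fun l : Fin n => z (s + l)) {G : Set (X → Bool)} (hG : g ∈ G)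
    {f₀ : X → Bool} (hf₀ : IsERM F (pseudoSample G z s n) f₀) :
    g ∈ empLowError F (pseudoSample G z s n) f₀
        (radius a (empRisk f₀ (pseudoSample G z s n))) ∧
      empLowError F (pseudoSample G z s n) f₀
        (radius a (empRisk f₀ (pseudoSample G z s n)))
        ⊆ ball P.fst F g (5 * risk P g + 7 * a) := by
  have hn0 : (0 : ℝ) < n := by exact_mod_cast hn
  have hgm := hFm g hmin.1
  set S := pseudoSample G z s n with hS
  set v : Fin n → X × Bool := fun l => z (s + l) with hv
  set ρ := empRisk f₀ S with hρ
  have hbb : ∀ f, hits Finset.univ (fun _ => disagreeOn g (errorSet g)ᶜ f) v / n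
      ≤ empRisk f S := by
    intro f
    rw [hS, empRisk_pseudoSample]
    exact div_le_div_of_nonneg_right
      (Finset.sum_le_sum fun l _ => indicator_disagreeOn_compl_le hG f _) hn0.le
  have hex : empRisk g S - ρ ≤ hits Finset.univ (fun _ => disagreeOn g (errorSet g) f₀) v / n
      - hits Finset.univ (fun _ => disagreeOn g (errorSet g)ᶜ f₀) v / n := by
    rw [hρ, hS, empRisk_pseudoSample, empRisk_pseudoSample, ← sub_div, ← sub_div]
    refine div_le_div_of_nonneg_right ?_ hn0.le
    unfold hits
    rw [← Finset.sum_sub_distrib, ← Finset.sum_sub_distrib]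
    exact Finset.sum_le_sum fun l _ => indicator_excess_le hG f₀ _
  have hbest : empRisk g S ≤ hits Finset.univ (fun _ => errorSet g) v / n := by
    rw [hS, empRisk_pseudoSample]
    exact div_le_div_of_nonneg_right
      (Finset.sum_le_sum fun l _ => indicator_pseudo_error_le hG _) hn0.le
  have hρ0 : 0 ≤ ρ := empRisk_nonneg _ _
  have hρg : ρ ≤ empRisk g S := hf₀.2 g hmin.1
  constructor
  · refine ⟨hmin.1, ?_⟩
    set b := hits Finset.univ (fun _ => disagreeOn g (errorSet g)ᶜ f₀) v / n with hb
    have hb0 : 0 ≤ b := div_nonneg (hits_nonneg _ _ _) hn0.le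
    set p := P.real (disagreeOn g (errorSet g)ᶜ f₀) with hp
    have hp0 : 0 ≤ p := measureReal_nonneg
    -- The first summand of the radius is the passage from `b` to `p`, the second the passage from
    -- the smaller probability in `h3` to its frequency. Together they give excess at most `radius a
    -- b`, and `b ≤ ρ`.
    have h1 : p ≤ b + (a + √(a * b)) := by
      refine le_of_sub_le_sqrt ha hb0 hp0 ((hgood.lower f₀ hf₀.1).trans ?_)
      have := Real.sqrt_nonneg (a * p)
      linarith
    have h2 := hgood.upper f₀ hf₀.1
    have h3 := real_disagreeOn_le hgm hmin hf₀.1 (hFm f₀ hf₀.1)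
    have h4 : √(a * P.real (disagreeOn g (errorSet g) f₀)) ≤ √(a * (b + (a + √(a * b)))) :=
      Real.sqrt_le_sqrt (mul_le_mul_of_nonneg_left (h3.trans h1) ha)
    have h5 := radius_mono ha (hbb f₀)
    rw [← hb] at h5
    unfold radius at h5 ⊢
    linarith
  · rintro f ⟨hf, hfr⟩
    refine ⟨hf, (real_fst_disagree_le hgm (hFm f hf)).trans ?_⟩
    exact add_le_five_mul_add ha measureReal_nonneg hρ0 measureReal_nonneg
      (hρg.trans (hbest.trans hgood.best)) ((hbb f).trans hfr) (hgood.lower f hf)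

end Stage

/-! ### The run of the algorithm -/

section Run

variable {X : Type*}

/-- The relative slack `A / n` used at time `s`. -/
def relSlack (δ : ℝ) (d s : ℕ) : ℝ := slackA (s / 2) (δ / (2 * s)) d / (s / 2)

theorem sigmaActive_eq_radius (t : ℕ) (δ : ℝ) (d : ℕ) (ρ : ℝ) :
    sigmaActive t δ d ρ = radius (relSlack δ d t) ρ := rfl

variable (F : Set (X → Bool)) (d : ℕ) (erm : List (X × Bool) → X → Bool) (δ : ℝ)
  (z : ℕ → X × Bool)

theorem run_succ_of_pow {t : ℕ} (ht : ∃ i : ℕ, t + 1 = 2 ^ i) :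
    (run F d erm δ z (t + 1)).sample = [] ∧
      (run F d erm δ z (t + 1)).lowError =
        empLowError F (pseudoLabelled (run F d erm δ z t).lowError (z t) ::
          (run F d erm δ z t).sample)
          (erm (pseudoLabelled (run F d erm δ z t).lowError (z t) :: (run F d erm δ z t).sample))
          (radius (relSlack δ d (t + 1))
            (empRisk (erm (pseudoLabelled (run F d erm δ z t).lowError (z t) ::
              (run F d erm δ z t).sample))
              (pseudoLabelled (run F d erm δ z t).lowError (z t) ::
                (run F d erm δ z t).sample))) := by
  rw [← sigmaActive_eq_radius]
  simp only [run, step, if_pos ht]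
  exact ⟨trivial, rfl⟩

theorem run_succ_of_not_pow {t : ℕ} (ht : ¬ ∃ i : ℕ, t + 1 = 2 ^ i) :
    (run F d erm δ z (t + 1)).sample =
        pseudoLabelled (run F d erm δ z t).lowError (z t) :: (run F d erm δ z t).sample ∧
      (run F d erm δ z (t + 1)).lowError = (run F d erm δ z t).lowError := by
  simp only [run, step, if_neg ht]
  exact ⟨rfl, trivial⟩

theorem run_succ_requested (t : ℕ) :
    ((run F d erm δ z (t + 1)).requested : ℝ) = (run F d erm δ z t).requested
      + (DIS (run F d erm δ z t).lowError).indicator (fun _ => (1 : ℝ)) (z t).1 := by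
  classical
  have hreq : (run F d erm δ z (t + 1)).requested =
      if (z t).1 ∈ AGR (run F d erm δ z t).lowError then (run F d erm δ z t).requested
      else (run F d erm δ z t).requested + 1 := by
    simp only [run, step]
    split_ifs <;> rfl
  have hiff : (z t).1 ∈ DIS (run F d erm δ z t).lowError ↔
      ¬ (z t).1 ∈ AGR (run F d erm δ z t).lowError := by
    simp [DIS, AGR]
  rw [hreq]
  by_cases h : (z t).1 ∈ AGR (run F d erm δ z t).lowError
  · rw [if_pos h, Set.indicator_of_notMem (fun h' => hiff.1 h' h), add_zero]
  · rw [if_neg h, Set.indicator_of_mem (hiff.2 h)]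
    push_cast
    rfl

theorem requested_eq_sum (m : ℕ) :
    ((run F d erm δ z m).requested : ℝ) = ∑ t ∈ Finset.range m,
      (DIS (run F d erm δ z t).lowError).indicator (fun _ => (1 : ℝ)) (z t).1 := by
  induction m with
  | zero => simp [run]
  | succ m ih => rw [run_succ_requested, ih, Finset.sum_range_succ]

theorem run_pow_lowError (i : ℕ) :
    (run F d erm δ z (2 ^ i)).sample = [] ∧ ∃ S, (run F d erm δ z (2 ^ i)).lowError =
      empLowError F S (erm S) (radius (relSlack δ d (2 ^ i)) (empRisk (erm S) S)) := by
  obtain ⟨t, ht⟩ : ∃ t, 2 ^ i = t + 1 := ⟨2 ^ i - 1, by have := Nat.two_pow_pos i; omega⟩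
  have h := run_succ_of_pow F d erm δ z ⟨i, ht.symm⟩
  rw [ht]
  exact ⟨h.1, _, h.2⟩

theorem not_pow_of_between {i j : ℕ} (hj : j + 1 < 2 ^ i) : ¬ ∃ k : ℕ, 2 ^ i + j + 1 = 2 ^ k := by
  rintro ⟨k, hk⟩
  have h1 : i < k := (Nat.pow_lt_pow_iff_right one_lt_two).1 (by omega)
  have h2 : 2 ^ (i + 1) ≤ 2 ^ k := Nat.pow_le_pow_right two_pos h1
  rw [pow_succ] at h2
  omega

theorem run_between (i : ℕ) {j : ℕ} (hj : j < 2 ^ i) :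
    (run F d erm δ z (2 ^ i + j)).lowError = (run F d erm δ z (2 ^ i)).lowError ∧
      (run F d erm δ z (2 ^ i + j)).sample =
        pseudoSample (run F d erm δ z (2 ^ i)).lowError z (2 ^ i) j := by
  induction j with
  | zero => exact ⟨rfl, by simpa [pseudoSample] using (run_pow_lowError F d erm δ z i).1⟩
  | succ j ih =>
    obtain ⟨h1, h2⟩ := ih (by omega)
    obtain ⟨h3, h4⟩ := run_succ_of_not_pow F d erm δ z (not_pow_of_between hj)
    rw [← add_assoc]
    exact ⟨h4.trans h1, by rw [h3, h1, h2, pseudoSample_succ]⟩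

theorem run_pow_succ_lowError (i : ℕ) :
    (run F d erm δ z (2 ^ (i + 1))).lowError =
      empLowError F (pseudoSample (run F d erm δ z (2 ^ i)).lowError z (2 ^ i) (2 ^ i))
        (erm (pseudoSample (run F d erm δ z (2 ^ i)).lowError z (2 ^ i) (2 ^ i)))
        (radius (relSlack δ d (2 ^ (i + 1)))
          (empRisk (erm (pseudoSample (run F d erm δ z (2 ^ i)).lowError z (2 ^ i) (2 ^ i)))
            (pseudoSample (run F d erm δ z (2 ^ i)).lowError z (2 ^ i) (2 ^ i)))) := by
  obtain ⟨j, hj⟩ : ∃ j, 2 ^ i = j + 1 := ⟨2 ^ i - 1, by have := Nat.two_pow_pos i; omega⟩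
  have hpow : 2 ^ (i + 1) = 2 ^ i + j + 1 := by rw [pow_succ]; omega
  obtain ⟨h1, h2⟩ := run_between F d erm δ z i (j := j) (by omega)
  have h := (run_succ_of_pow F d erm δ z ⟨i + 1, hpow.symm⟩).2
  rw [h1, h2, ← pseudoSample_succ, ← hj, ← hpow] at h
  exact h

theorem lowError_subset (t : ℕ) : (run F d erm δ z t).lowError ⊆ F := by
  induction t with
  | zero => exact subset_rfl
  | succ t ih =>
    by_cases ht : ∃ i : ℕ, t + 1 = 2 ^ i
    · rw [(run_succ_of_pow F d erm δ z ht).2]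
      exact fun f hf => hf.1
    · rw [(run_succ_of_not_pow F d erm δ z ht).2]
      exact ih

theorem lowError_eq_log {t : ℕ} (ht : t ≠ 0) :
    (run F d erm δ z t).lowError = (run F d erm δ z (2 ^ Nat.log 2 t)).lowError := by
  obtain ⟨j, hj⟩ := Nat.exists_eq_add_of_le (Nat.pow_log_le_self 2 ht)
  have hlt := Nat.lt_pow_succ_log_self one_lt_two t
  have := (run_between F d erm δ z (Nat.log 2 t) (j := j) (by
    rw [Nat.succ_eq_add_one, pow_succ] at hlt; omega)).1
  rwa [← hj] at this

theorem one_le_radius {a ρ : ℝ} (ha : 1 / 2 ≤ a) : 1 ≤ radius a ρ := by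
  unfold radius
  have := Real.sqrt_nonneg (a * ρ)
  have := Real.sqrt_nonneg (a * (ρ + (a + √(a * ρ))))
  linarith

variable {F d erm δ z}

/-- A radius of at least `1` excludes nobody, whatever the sample. Such a stage also forgets
anything that went wrong before it. -/
theorem lowError_eq_of_half_le {i : ℕ} (h : 1 / 2 ≤ relSlack δ d (2 ^ i)) :
    (run F d erm δ z (2 ^ i)).lowError = F := by
  obtain ⟨-, S, hS⟩ := run_pow_lowError F d erm δ z i
  refine (lowError_subset F d erm δ z _).antisymm fun f hf => ?_
  rw [hS]
  refine ⟨hf, ?_⟩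
  have h1 := empRisk_le_one f S
  have h2 := empRisk_nonneg (erm S) S
  have h3 := one_le_radius (ρ := empRisk (erm S) S) h
  linarith

theorem log_sixteen_exp : Real.log (16 * Real.exp 1) = 4 * Real.log 2 + 1 := by
  rw [Real.log_mul (by norm_num) (Real.exp_pos 1).ne', Real.log_exp,
    show (16 : ℝ) = 2 ^ 4 by norm_num, Real.log_pow]
  norm_num

theorem slackA_stage {s : ℕ} (hs : 0 < s) (hδ : 0 < δ) (hd : 1 ≤ d) :
    slackA (s / 2) (δ / (2 * s)) d
      = 4 * d * Real.log (16 * Real.exp 1 * (s ^ 2 / (d * δ))) := by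
  have hs0 : (0 : ℝ) < s := by exact_mod_cast hs
  have hd0 : (0 : ℝ) < d := by exact_mod_cast hd
  unfold slackA
  congr 2
  field_simp

/-- A small relative slack is only possible when the sample is large. -/
theorem of_relSlack_lt_half {s : ℕ} (hd : 1 ≤ d) (hds : d ≤ s) (hδ : 0 < δ) (hδ1 : δ ≤ 1)
    (h : relSlack δ d s < 1 / 2) :
    60 * d < s ∧ 32 ≤ slackA (s / 2) (δ / (2 * s)) d ∧ 0 ≤ relSlack δ d s := by
  have hd1 : (1 : ℝ) ≤ d := by exact_mod_cast hd
  have hs1 : (d : ℝ) ≤ s := by exact_mod_cast hds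
  have hs0 : (0 : ℝ) < s := by linarith
  have hl2 := Real.log_two_gt_d9
  have h16 := log_sixteen_exp
  have hA := slackA_stage (d := d) (δ := δ) (s := s) (by omega) hδ hd
  have hdδ : (d : ℝ) * δ ≤ d := by nlinarith
  have hq : (s : ℝ) ≤ s ^ 2 / (d * δ) := by
    rw [le_div_iff₀ (by positivity)]; nlinarith
  have hlog : Real.log (16 * Real.exp 1 * (s ^ 2 / (d * δ)))
      = Real.log (16 * Real.exp 1) + Real.log (s ^ 2 / (d * δ)) :=
    Real.log_mul (by positivity) (by positivity)
  have hlog0 : 0 ≤ Real.log (s ^ 2 / (d * δ)) := Real.log_nonneg (by linarith)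
  have hAlow : 4 * d * (377 / 100) ≤ slackA (s / 2) (δ / (2 * s)) d := by
    rw [hA]
    exact mul_le_mul_of_nonneg_left (by linarith) (by positivity)
  have h60 : 60 * (d : ℝ) < s := by
    unfold relSlack at h
    rw [div_lt_iff₀ (by positivity)] at h
    linarith
  refine ⟨by exact_mod_cast h60, ?_, ?_⟩
  -- From `s > 60d`, `s² / (dδ) ≥ 3600`; this makes the logarithm at least `8`, hence `A ≥ 32`, as
  -- the deviation bounds require.
  · have hbig : (2 : ℝ) ^ 10 ≤ s ^ 2 / (d * δ) := by
      rw [le_div_iff₀ (by positivity)]; nlinarith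
    have h10 := Real.log_le_log (by positivity) hbig
    rw [Real.log_pow] at h10
    rw [hA]
    push_cast at h10
    have : 8 ≤ Real.log (16 * Real.exp 1 * (s ^ 2 / (d * δ))) := by linarith
    nlinarith
  · unfold relSlack
    exact div_nonneg (by nlinarith) (by positivity)

variable [MeasurableSpace X] {P : Measure (X × Bool)} [IsProbabilityMeasure P] {g : X → Bool}

/-- The stream satisfies the deviation bounds in all stages where they matter. -/
def GoodStream (P : Measure (X × Bool)) (F : Set (X → Bool)) (g : X → Bool) (d : ℕ) (δ : ℝ)
    (z : ℕ → X × Bool) : Prop :=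
  ∀ i : ℕ, d ≤ 2 ^ (i + 1) → relSlack δ d (2 ^ (i + 1)) < 1 / 2 →
    GoodSample P F g (relSlack δ d (2 ^ (i + 1))) fun l : Fin (2 ^ i) => z (2 ^ i + l)

theorem subset_ball_of_one_le {r : ℝ} (hr : 1 ≤ r) : F ⊆ ball P.fst F g r :=
  fun _ hf => ⟨hf, measureReal_le_one.trans hr⟩

theorem one_le_ball_radius {R a : ℝ} (hR : 0 ≤ R) (ha : 1 / 2 ≤ a) : 1 ≤ 5 * R + 7 * a := by
  linarith

/-- Nothing is claimed before time `d`, where `g` may have been lost. A slack below `1/2` forces `2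
^ i > 60 d`, so the preceding stage is still covered by the induction; with a larger slack the
low-error set is all of `F`, which restarts it. -/
theorem GoodStream.lowError (hFm : ∀ f ∈ F, Measurable f) (hmin : IsRiskMinimizer P F g)
    (hd : 1 ≤ d) (herm : ∀ S, IsERM F S (erm S)) (hδ : 0 < δ) (hδ1 : δ ≤ 1)
    (hgood : GoodStream P F g d δ z) (i : ℕ) (hi : d ≤ 2 ^ i) :
    g ∈ (run F d erm δ z (2 ^ i)).lowError ∧
      (run F d erm δ z (2 ^ i)).lowError
        ⊆ ball P.fst F g (5 * risk P g + 7 * relSlack δ d (2 ^ i)) := by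
  have hR : 0 ≤ risk P g := measureReal_nonneg
  induction i with
  | zero =>
    rcases le_or_gt (1 / 2) (relSlack δ d (2 ^ 0)) with h | h
    · rw [lowError_eq_of_half_le h]
      exact ⟨hmin.1, subset_ball_of_one_le (one_le_ball_radius hR h)⟩
    · have := (of_relSlack_lt_half hd hi hδ hδ1 h).1
      norm_num at this
      omega
  | succ i ih =>
    rcases le_or_gt (1 / 2) (relSlack δ d (2 ^ (i + 1))) with h | h
    · rw [lowError_eq_of_half_le h]
      exact ⟨hmin.1, subset_ball_of_one_le (one_le_ball_radius hR h)⟩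
    · obtain ⟨h1, -, h2⟩ := of_relSlack_lt_half hd hi hδ hδ1 h
      obtain ⟨hg, -⟩ := ih (by rw [pow_succ] at h1; omega)
      rw [run_pow_succ_lowError]
      exact (hgood i hi h).stage hFm hmin h2 (by positivity) hg (herm _)

end Run

/-! ### The probability of a good stream -/

section Probability

variable {X : Type*} [MeasurableSpace X] {F : Set (X → Bool)} {d : ℕ} {g : X → Bool}

theorem exp_neg_slackA_stage {δ : ℝ} {s : ℕ} (hs : 0 < s) (hδ : 0 < δ) (hd : 1 ≤ d) :
    Real.exp (-(slackA (s / 2) (δ / (2 * s)) d / 4))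
      = (d * δ / (16 * Real.exp 1 * s ^ 2)) ^ d := by
  have hs0 : (0 : ℝ) < s := by exact_mod_cast hs
  have hd0 : (0 : ℝ) < d := by exact_mod_cast hd
  have hpos : 0 < d * δ / (16 * Real.exp 1 * (s : ℝ) ^ 2) := by positivity
  rw [slackA_stage hs hδ hd, ← Real.exp_log (pow_pos hpos d), Real.log_pow]
  congr 1
  have : 16 * Real.exp 1 * ((s : ℝ) ^ 2 / (d * δ))
      = (d * δ / (16 * Real.exp 1 * (s : ℝ) ^ 2))⁻¹ := by
    rw [inv_div]; ring
  rw [this, Real.log_inv]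
  ring

variable (P : Measure (X × Bool)) [IsProbabilityMeasure P]

/-- The deviation `y` is the positive root of `y² = (a/2)(R + y)`, making the Chernoff exponent
`an/4`. -/
theorem measure_best_deviation_le (hgm : Measurable g) {n : ℕ} (hn : 0 < n) {a : ℝ} (ha : 0 < a) :
    Measure.infinitePi (fun _ : Fin n => P)
      {v | risk P g + (a / 4 + √(a ^ 2 / 16 + a * risk P g / 2))
        < hits Finset.univ (fun _ => errorSet g) v / n}
      ≤ ENNReal.ofReal (Real.exp (-(a * n / 4))) := by
  have hn0 : (0 : ℝ) < n := by exact_mod_cast hn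
  set R := risk P g with hR
  have hR0 : 0 ≤ R := measureReal_nonneg
  set y := a / 4 + √(a ^ 2 / 16 + a * R / 2) with hy
  have hy0 : 0 < y := by positivity
  have hsum : ∑ _i : Fin n, P.real (errorSet g) ≤ n * R := by
    simp [hR, risk, errorSet]
  have h := measure_hits_ge_le (fun _ : Fin n => P) Finset.univ (B := fun _ => errorSet g)
    (fun _ => measurableSet_errorSet hgm) hsum (x := n * y) (by positivity)
  refine (measure_mono fun v hv => ?_).trans (h.trans_eq ?_)
  · rw [Set.mem_ofPred_eq, lt_div_iff₀ hn0] at hv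
    rw [Set.mem_ofPred_eq]
    linarith
  · congr 3
    have hs := Real.sq_sqrt (show 0 ≤ a ^ 2 / 16 + a * R / 2 by positivity)
    have hy2 : y ^ 2 = a / 2 * (R + y) := by rw [hy]; nlinarith
    rw [mul_pow, hy2, ← mul_add]
    have : R + y ≠ 0 := by positivity
    field_simp
    norm_num

/-- Two uniform bounds fail with probability at most `2δ/s` each and the bound for `g` alone with at
most `δ/s`, where `s = 2 ^ (i + 1)`. -/
theorem measure_not_goodSample_le (hF : PointwiseMeasurable F)
    (hvc : ∀ S : Finset X, Shatters F S → S.card ≤ d) (hd : 1 ≤ d) (hg : g ∈ F) {δ : ℝ}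
    (hδ : 0 < δ) (hδ1 : δ ≤ 1) {i : ℕ} (hi : d ≤ 2 ^ (i + 1))
    (hslack : relSlack δ d (2 ^ (i + 1)) < 1 / 2) :
    Measure.infinitePi (fun _ : ℕ => P)
      {z | ¬ GoodSample P F g (relSlack δ d (2 ^ (i + 1))) fun l : Fin (2 ^ i) => z (2 ^ i + l)}
      ≤ ENNReal.ofReal (5 * (δ / 2 ^ (i + 1))) := by
  obtain ⟨h60, hA, ha0⟩ := of_relSlack_lt_half hd hi hδ hδ1 hslack
  have hgm := hF.1 g hg
  have hE := measurableSet_errorSet hgm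
  have hexp := exp_neg_slackA_stage (d := d) (s := 2 ^ (i + 1)) (by positivity) hδ hd
  set a := relSlack δ d (2 ^ (i + 1)) with ha
  set A := slackA ((2 ^ (i + 1) : ℕ) / 2) (δ / (2 * (2 ^ (i + 1) : ℕ))) d with hAdef
  set n := 2 ^ i with hn
  have hn1 : 0 < n := by positivity
  have hs2n : ((2 ^ (i + 1) : ℕ) : ℝ) = 2 * n := by rw [hn]; push_cast; ring
  have hs2n' : (2 : ℝ) ^ (i + 1) = 2 * n := by rw [hn]; push_cast; ring
  have hn0 : (0 : ℝ) < n := by exact_mod_cast hn1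
  have hd0 : (1 : ℝ) ≤ d := by exact_mod_cast hd
  have haA : A = a * n := by
    rw [ha, relSlack, ← hAdef, hs2n]; field_simp
  have hdn : d ≤ n := by rw [pow_succ] at h60; omega
  have hdn' : (d : ℝ) ≤ n := by exact_mod_cast hdn
  have hapos : 0 < a := by
    by_contra hcon
    nlinarith
  have hlow := measure_class_lower_deviation_le (F := F) P hF hvc hd hdn hgm hE.compl hA
  have hupp := measure_class_upper_deviation_le (F := F) P hF hvc hd hdn hgm hE hA
  have hbest := measure_best_deviation_le P hgm hn1 hapos
  rw [← haA] at hbest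
  -- Here the form of `A` and the 32 columns meet: the growth bound `(32en/d)^d` times `(dδ /
  -- (64en²))^d` is exactly `(δ/(2n))^d`.
  have hgrow : 2 * ((Real.exp 1 * (n * 32) / d) ^ d * Real.exp (-(A / 4))) ≤ 2 * (δ / (2 * n)) := by
    rw [hexp, hs2n, ← mul_pow]
    have : Real.exp 1 * (n * 32) / d * (d * δ / (16 * Real.exp 1 * (2 * (n : ℝ)) ^ 2))
        = δ / (2 * n) := by
      field_simp; norm_num
    rw [this]
    refine mul_le_mul_of_nonneg_left (pow_le_of_le_one (by positivity) ?_ (by omega)) two_pos.le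
    rw [div_le_one (by positivity)]
    linarith
  have hsingle : Real.exp (-(A / 4)) ≤ δ / (2 * n) := by
    rw [hexp, hs2n]
    have he := Real.exp_one_gt_d9
    have hle : d * δ / (16 * Real.exp 1 * (2 * (n : ℝ)) ^ 2) ≤ δ / (2 * n) := by
      rw [div_le_div_iff₀ (by positivity) (by positivity)]
      have h1 : (d : ℝ) * δ * (2 * n) ≤ δ * (2 * n) * n := by
        have := mul_le_mul_of_nonneg_left hdn' (show 0 ≤ δ * (2 * n) by positivity)
        linarith
      have h2 : δ * (2 * n) * n ≤ δ * (16 * Real.exp 1 * (2 * (n : ℝ)) ^ 2) := by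
        have h3 : 0 ≤ δ * (n : ℝ) ^ 2 := by positivity
        nlinarith
      linarith
    have h1 : d * δ / (16 * Real.exp 1 * (2 * (n : ℝ)) ^ 2) ≤ 1 := by
      refine hle.trans ?_
      rw [div_le_one (by positivity)]
      linarith
    exact (pow_le_of_le_one (by positivity) h1 (by omega)).trans hle
  have hlaw := Measure.map_infinitePi_infinitePi_of_inj (P := fun _ : ℕ => P)
    (f := fun l : Fin n => n + (l : ℕ)) fun l l' h => Fin.ext (by simpa using h)
  have hmeas : Measurable fun (z : ℕ → X × Bool) (l : Fin n) => z (n + l) := by fun_prop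
  set BL := {v : Fin n → X × Bool | ∃ f ∈ F,
    4 / 5 * √(A * (n * P.real (disagreeOn g (errorSet g)ᶜ f)))
      < n * P.real (disagreeOn g (errorSet g)ᶜ f)
        - hits Finset.univ (fun _ => disagreeOn g (errorSet g)ᶜ f) v}
  set BU := {v : Fin n → X × Bool | ∃ f ∈ F,
    n * P.real (disagreeOn g (errorSet g) f) + A
      + √(A * (n * P.real (disagreeOn g (errorSet g) f)))
      < hits Finset.univ (fun _ => disagreeOn g (errorSet g) f) v}
  set BB := {v : Fin n → X × Bool | risk P g + (a / 4 + √(a ^ 2 / 16 + a * risk P g / 2))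
        < hits Finset.univ (fun _ => errorSet g) v / n}
  have hroot : ∀ p : ℝ, √(A * (n * p)) = n * √(a * p) := by
    intro p
    rw [haA, show a * n * (n * p) = (n : ℝ) ^ 2 * (a * p) by ring,
      Real.sqrt_mul (by positivity), Real.sqrt_sq hn0.le]
  have hsub : {z | ¬ GoodSample P F g a fun l : Fin n => z (n + l)} ⊆
      (fun (z : ℕ → X × Bool) (l : Fin n) => z (n + l)) ⁻¹' (BL ∪ BU ∪ BB) := by
    intro z hz
    by_contra hcon
    simp only [Set.mem_preimage, Set.mem_union, not_or] at hcon
    obtain ⟨⟨h1, h2⟩, h3⟩ := hcon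
    refine hz ⟨fun f hf => ?_, fun f hf => ?_, not_lt.1 h3⟩
    · by_contra hlt
      refine h1 ⟨f, hf, ?_⟩
      rw [hroot]
      rw [not_le, lt_sub_iff_add_lt, ← lt_sub_iff_add_lt', div_lt_iff₀ hn0] at hlt
      linarith
    · by_contra hlt
      refine h2 ⟨f, hf, ?_⟩
      rw [hroot, haA]
      rw [not_le, lt_div_iff₀ hn0] at hlt
      linarith
  calc _ ≤ _ := measure_mono hsub
    -- This direction holds for arbitrary sets; the suprema over `F` are not known to be measurable.
    _ ≤ _ := Measure.le_map_apply hmeas.aemeasurable _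
    _ = Measure.infinitePi (fun _ : Fin n => P) (BL ∪ BU ∪ BB) := by rw [hlaw]
    _ ≤ ENNReal.ofReal (2 * (δ / (2 * n))) + ENNReal.ofReal (2 * (δ / (2 * n)))
        + ENNReal.ofReal (δ / (2 * n)) := by
        refine (measure_union_le _ _).trans (add_le_add ((measure_union_le _ _).trans
          (add_le_add ?_ ?_)) ?_)
        · exact hlow.trans (ENNReal.ofReal_le_ofReal hgrow)
        · exact hupp.trans (ENNReal.ofReal_le_ofReal hgrow)
        · exact hbest.trans (ENNReal.ofReal_le_ofReal hsingle)
    _ = ENNReal.ofReal (5 * (δ / 2 ^ (i + 1))) := by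
        rw [← ENNReal.ofReal_add (by positivity) (by positivity),
          ← ENNReal.ofReal_add (by positivity) (by positivity), hs2n']
        congr 1
        ring

theorem measure_not_goodStream_le (hF : PointwiseMeasurable F)
    (hvc : ∀ S : Finset X, Shatters F S → S.card ≤ d) (hd : 1 ≤ d) (hg : g ∈ F) {δ : ℝ}
    (hδ : 0 < δ) (hδ1 : δ ≤ 1) :
    Measure.infinitePi (fun _ : ℕ => P) {z | ¬ GoodStream P F g d δ z} ≤ ENNReal.ofReal δ := by
  set bad : ℕ → Set (ℕ → X × Bool) := fun i => {z | d ≤ 2 ^ (i + 1) ∧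
    relSlack δ d (2 ^ (i + 1)) < 1 / 2 ∧
      ¬ GoodSample P F g (relSlack δ d (2 ^ (i + 1))) fun l : Fin (2 ^ i) => z (2 ^ i + l)}
  have hsub : {z | ¬ GoodStream P F g d δ z} ⊆ ⋃ k, bad (k + 5) := by
    intro z hz
    simp only [GoodStream, Set.mem_ofPred_eq, not_forall] at hz
    obtain ⟨i, h1, h2, h3⟩ := hz
    have h60 := (of_relSlack_lt_half hd h1 hδ hδ1 h2).1
    -- Only stages with `2 ^ (i + 1) > 60` can be bad. Starting the geometric series there pays for
    -- the factor `5`.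
    have hi : 5 ≤ i := by
      by_contra hcon
      have : 2 ^ (i + 1) ≤ 2 ^ 5 := Nat.pow_le_pow_right two_pos (by omega)
      omega
    obtain ⟨k, rfl⟩ := Nat.exists_eq_add_of_le' hi
    exact Set.mem_iUnion.2 ⟨k, h1, h2, h3⟩
  have hbad : ∀ k, Measure.infinitePi (fun _ : ℕ => P) (bad (k + 5))
      ≤ ENNReal.ofReal (δ / 2 / 2 ^ k) := by
    intro k
    by_cases h : d ≤ 2 ^ (k + 5 + 1) ∧ relSlack δ d (2 ^ (k + 5 + 1)) < 1 / 2
    · refine (measure_mono fun z hz => hz.2.2).trans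
        ((measure_not_goodSample_le P hF hvc hd hg hδ hδ1 h.1 h.2).trans
          (ENNReal.ofReal_le_ofReal ?_))
      have h2 : (0 : ℝ) < 2 ^ k := by positivity
      have h1 : (2 : ℝ) ^ (k + 5 + 1) = 64 * 2 ^ k := by ring
      rw [h1, div_div, ← mul_div_assoc, div_le_div_iff₀ (by positivity) (by positivity)]
      have := mul_pos hδ h2
      nlinarith
    · have : bad (k + 5) = ∅ :=
        Set.eq_empty_of_forall_notMem fun z hz => h ⟨hz.1, hz.2.1⟩
      rw [this, measure_empty]
      exact zero_le
  refine (measure_mono hsub).trans ((measure_iUnion_le _).trans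
    ((ENNReal.tsum_le_tsum hbad).trans_eq ?_))
  rw [← ENNReal.ofReal_tsum_of_nonneg (fun k => by positivity) (summable_geometric_two' δ),
    tsum_geometric_two' δ]

end Probability

/-! ### The expected number of requests -/

section Sums

/-- Every full dyadic block contributes `1`; the last block contributes the fraction reached by `m`.
-/
theorem sum_inv_pow_log (k : ℕ) {m : ℕ} (hm : 2 ^ k ≤ m) :
    ∑ t ∈ Finset.Ico (2 ^ k) m, ((2 : ℝ) ^ Nat.log 2 t)⁻¹
      = Nat.log 2 m + (m / 2 ^ Nat.log 2 m - 1) - k := by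
  induction m, hm using Nat.le_induction with
  | base => simp [Nat.log_pow one_lt_two]
  | succ m hm ih =>
    have hm0 : m ≠ 0 := by have := Nat.two_pow_pos k; omega
    rw [Finset.sum_Ico_succ_top hm, ih]
    have h1 := Nat.pow_log_le_self 2 hm0
    have h2 := Nat.lt_pow_succ_log_self one_lt_two m
    rcases (Nat.succ_le_of_lt h2).lt_or_eq with h | h
    · have hlog : Nat.log 2 (m + 1) = Nat.log 2 m :=
        (Nat.log_eq_iff (Or.inr ⟨one_lt_two, by omega⟩)).2 ⟨by omega, h⟩
      rw [hlog]
      push_cast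
      ring
    · have hm' : m + 1 = 2 ^ (Nat.log 2 m + 1) := h
      have hlog : Nat.log 2 (m + 1) = Nat.log 2 m + 1 := by
        conv_lhs => rw [hm']
        exact Nat.log_pow one_lt_two _
      have hcast : (m : ℝ) + 1 = 2 ^ (Nat.log 2 m + 1) := by exact_mod_cast hm'
      rw [hlog]
      push_cast
      rw [hcast, div_self (by positivity), eq_sub_of_add_eq hcast, pow_succ]
      field_simp
      ring

theorem sum_inv_pow_log_le (k : ℕ) {m : ℕ} (hm : 2 ^ k ≤ m) :
    ∑ t ∈ Finset.Ico (2 ^ k) m, ((2 : ℝ) ^ Nat.log 2 t)⁻¹ ≤ Real.logb 2 m - k := by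
  have hm0 : m ≠ 0 := by have := Nat.two_pow_pos k; omega
  rw [sum_inv_pow_log k hm]
  set L := Nat.log 2 m with hL
  have h1 : (2 : ℝ) ^ L ≤ m := by exact_mod_cast Nat.pow_log_le_self 2 hm0
  have h2 : (m : ℝ) ≤ 2 ^ (L + 1) := by
    exact_mod_cast (Nat.lt_pow_succ_log_self one_lt_two m).le
  have hpos : (0 : ℝ) < 2 ^ L := by positivity
  set y : ℝ := m / 2 ^ L - 1 with hy
  have hy0 : 0 ≤ y := by rw [hy, sub_nonneg, one_le_div hpos]; exact h1
  have hy1 : y ≤ 1 := by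
    rw [hy, sub_le_iff_le_add, div_le_iff₀ hpos]
    rw [pow_succ] at h2
    linarith
  -- Bernoulli gives `2^y ≤ 1 + y` on `[0, 1]`, so linear interpolation of `log₂` between powers of
  -- two lies below `log₂`.
  have hbern := rpow_one_add_le_one_add_mul_self (s := 1) (by norm_num) hy0 hy1
  norm_num at hbern
  have hmy : (m : ℝ) = 2 ^ (L : ℝ) * (1 + y) := by
    rw [hy, Real.rpow_natCast]; field_simp; ring
  have hle : (L : ℝ) + y ≤ Real.logb 2 m := by
    rw [Real.le_logb_iff_rpow_le one_lt_two (by positivity), Real.rpow_add two_pos, hmy]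
    gcongr
  linarith

end Sums

/-! ### Disagreement mass and the disagreement coefficient. -/

section Disagreement

variable {X : Type*} {F : Set (X → Bool)} {g : X → Bool}

theorem DIS_mono {G G' : Set (X → Bool)} (h : G ⊆ G') : DIS G ⊆ DIS G' :=
  fun _ ⟨f₁, h₁, f₂, h₂, hne⟩ => ⟨f₁, h h₁, f₂, h h₂, hne⟩

variable [MeasurableSpace X] {PX : Measure X}

theorem ball_mono {r r' : ℝ} (h : r ≤ r') : ball PX F g r ⊆ ball PX F g r' :=
  fun _ hf => ⟨hf.1, hf.2.trans h⟩

variable [IsProbabilityMeasure PX]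

theorem real_DIS_ball_le_mul_disCoeff {r₀ r : ℝ} (hr₀ : 0 < r₀) (hr : r₀ < r) :
    PX.real (DIS (ball PX F g r)) ≤ r * disCoeff PX F g r₀ := by
  have hr0 : 0 < r := hr₀.trans hr
  have hbdd : BddAbove (Set.range fun r : Set.Ioi r₀ =>
      PX.real (DIS (ball PX F g r)) / (r : ℝ)) := by
    refine ⟨1 / r₀, ?_⟩
    rintro _ ⟨⟨x, hx⟩, rfl⟩
    have hx' : r₀ < x := hx
    exact div_le_div₀ zero_le_one measureReal_le_one hr₀ hx'.le
  have h := le_ciSup hbdd ⟨r, hr⟩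
  rw [mul_comm]
  exact (div_le_iff₀ hr0).1 h

/-- The supremum runs over radii strictly above `r₀`, so the case `M = r₀` is reached by letting the
radius decrease to `M`. -/
theorem real_DIS_ball_le {r₀ b : ℝ} (hr₀ : 0 < r₀) (hb : disCoeff PX F g r₀ ≤ b) {r M : ℝ}
    (hr : r ≤ M) (hM : r₀ ≤ M) : PX.real (DIS (ball PX F g r)) ≤ M * b := by
  have hlim : Tendsto (fun x : ℝ => x * b) (𝓝[>] M) (𝓝 (M * b)) :=
    ((continuous_id.mul continuous_const).tendsto M).mono_left nhdsWithin_le_nhds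
  refine ge_of_tendsto hlim ?_
  filter_upwards [self_mem_nhdsWithin] with x hx
  have hx' : M < x := hx
  calc PX.real (DIS (ball PX F g r)) ≤ PX.real (DIS (ball PX F g x)) :=
        measureReal_mono (DIS_mono (ball_mono (hr.trans hx'.le)))
    _ ≤ x * disCoeff PX F g r₀ := real_DIS_ball_le_mul_disCoeff hr₀ (hM.trans_lt hx')
    _ ≤ x * b := mul_le_mul_of_nonneg_left hb (by linarith)

end Disagreement

/-! ### The mean of the dominating sum. -/

section Mean

theorem slackA_eq {m d : ℕ} {δ : ℝ} :
    slackA m δ d = 4 * d * Real.log (16 * m * Real.exp 1 / (d * δ)) := rfl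

theorem le_log_slack {m d : ℕ} {δ : ℝ} (hd : 1 ≤ d) (hdm : d ≤ m) (hδ : 0 < δ) (hδ1 : δ ≤ 1) :
    377 / 100 + Real.log (m / d) ≤ Real.log (16 * m * Real.exp 1 / (d * δ)) := by
  have hd0 : (0 : ℝ) < d := by exact_mod_cast hd
  have hm0 : (0 : ℝ) < m := by exact_mod_cast hd.trans hdm
  have e : 16 * m * Real.exp 1 / (d * δ) = 16 * Real.exp 1 * (m / d) * δ⁻¹ := by
    field_simp
  rw [e, Real.log_mul (by positivity) (by positivity), Real.log_mul (by positivity) (by positivity),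
    log_sixteen_exp, Real.log_inv]
  have h1 := Real.log_nonpos hδ.le hδ1
  have h2 := Real.log_two_gt_d9
  linarith

theorem le_slackA {m d : ℕ} {δ : ℝ} (hd : 1 ≤ d) (hdm : d ≤ m) (hδ : 0 < δ) (hδ1 : δ ≤ 1) :
    15 * (d : ℝ) ≤ slackA m δ d := by
  have hd0 : (0 : ℝ) < d := by exact_mod_cast hd
  have hdm' : (d : ℝ) ≤ m := by exact_mod_cast hdm
  have h := le_log_slack hd hdm hδ hδ1
  have h0 : 0 ≤ Real.log (m / d) := Real.log_nonneg ((one_le_div hd0).2 hdm')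
  rw [slackA_eq]
  nlinarith

theorem seven_relSlack_le {m d s : ℕ} {δ : ℝ} (hd : 1 ≤ d) (hs : 0 < s) (hsm : s ≤ m)
    (hδ : 0 < δ) :
    7 * relSlack (δ / 2) d s
      ≤ 56 * d * (Real.log (16 * m * Real.exp 1 / (d * δ)) + Real.log (2 * m)) * (s : ℝ)⁻¹ := by
  have hd0 : (0 : ℝ) < d := by exact_mod_cast hd
  have hs0 : (0 : ℝ) < s := by exact_mod_cast hs
  have hsm' : (s : ℝ) ≤ m := by exact_mod_cast hsm
  have hm0 : (0 : ℝ) < m := hs0.trans_le hsm'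
  rw [relSlack, slackA_stage hs (half_pos hδ) hd,
    ← Real.log_mul (by positivity) (by positivity)]
  have hlog : Real.log (16 * Real.exp 1 * ((s : ℝ) ^ 2 / (d * (δ / 2))))
      ≤ Real.log (16 * m * Real.exp 1 / (d * δ) * (2 * m)) := by
    apply Real.log_le_log (by positivity)
    have e : 16 * m * Real.exp 1 / (d * δ) * (2 * m)
        = 16 * Real.exp 1 * ((m : ℝ) ^ 2 / (d * (δ / 2))) := by field_simp
    rw [e]
    gcongr
  calc _ = 56 * d * Real.log (16 * Real.exp 1 * ((s : ℝ) ^ 2 / (d * (δ / 2)))) * (s : ℝ)⁻¹ := by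
        field_simp; ring
    _ ≤ _ := by gcongr

/-- The radius of a ball that contains the low-error set at time `t` on a good stream. -/
def ballRadius (R δ : ℝ) (d t : ℕ) : ℝ :=
  if t ≠ 0 ∧ d ≤ 2 ^ Nat.log 2 t then 5 * R + 7 * relSlack (δ / 2) d (2 ^ Nat.log 2 t) else 1

variable {X : Type*} [MeasurableSpace X] {PX : Measure X} [IsProbabilityMeasure PX]
  {F : Set (X → Bool)} {g : X → Bool}

theorem real_DIS_le_real_DIS_ball_one (r : ℝ) :
    PX.real (DIS (ball PX F g r)) ≤ PX.real (DIS (ball PX F g 1)) :=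
  measureReal_mono (DIS_mono fun _ hf => ⟨hf.1, measureReal_le_one⟩)

/-- The slack of a stage carries an extra `log (2m)` compared with `A(m, δ)`. Skipping the first `k`
blocks compensates: `(log₂ m - k) log 2 ≤ log (m/d)`, and `log (m/d)` is already contained in the
logarithm `Λ` of `A`. -/
theorem slack_sum_le {m d k : ℕ} {δ : ℝ} (hd : 1 ≤ d) (hk1 : d ≤ 2 ^ k) (hk2 : 2 ^ k ≤ 2 * d)
    (hkm : 2 ^ k ≤ m) (hm : 2 ≤ m) (hδ : 0 < δ) (hδ1 : δ ≤ 1) :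
    (2 : ℝ) ^ k + 56 * d * (Real.log (16 * m * Real.exp 1 / (d * δ)) + Real.log (2 * m))
        * (Real.logb 2 m - k)
      ≤ 28 * slackA m δ d * Real.logb 2 m := by
  have hd1 : (1 : ℝ) ≤ d := by exact_mod_cast hd
  have hm2 : (2 : ℝ) ≤ m := by exact_mod_cast hm
  have hm0 : (0 : ℝ) < m := by linarith
  have hk1' : (d : ℝ) ≤ 2 ^ k := by exact_mod_cast hk1
  have hk2' : (2 : ℝ) ^ k ≤ 2 * d := by exact_mod_cast hk2
  have hkm' : (2 : ℝ) ^ k ≤ m := by exact_mod_cast hkm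
  have hdm : d ≤ m := hk1.trans hkm
  have hl2 : 0 < Real.log 2 := Real.log_pos one_lt_two
  have hΛ := le_log_slack hd hdm hδ hδ1
  rw [slackA_eq]
  set Λ := Real.log (16 * m * Real.exp 1 / (d * δ))
  have hlogm : Real.log m = Real.logb 2 m * Real.log 2 := by rw [Real.logb]; field_simp
  set L := Real.logb 2 m
  have hL1 : 1 ≤ L := by
    rw [Real.le_logb_iff_rpow_le one_lt_two hm0]; simpa using hm2
  set x := Real.log (m / d) with hx
  have hx0 : 0 ≤ x := Real.log_nonneg ((one_le_div (by linarith)).2 (hk1'.trans hkm'))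
  have hxm : x ≤ L * Real.log 2 := by
    rw [← hlogm]
    exact Real.log_le_log (by positivity) (div_le_self hm0.le hd1)
  have hw : (L - k) * Real.log 2 ≤ x := by
    have h1 : (k : ℝ) * Real.log 2 = Real.log (2 ^ k) := by rw [Real.log_pow]
    rw [sub_mul, h1, ← hlogm, ← Real.log_div hm0.ne' (by positivity)]
    exact Real.log_le_log (by positivity) (by gcongr)
  have hLk : 0 ≤ L - k := by
    have : (k : ℝ) ≤ L := by
      rw [Real.le_logb_iff_rpow_le one_lt_two hm0, Real.rpow_natCast]; exact hkm'
    linarith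
  have hlog2m : Real.log (2 * m) = (1 + L) * Real.log 2 := by
    rw [Real.log_mul two_ne_zero hm0.ne', hlogm]; ring
  have hl2' := Real.log_two_lt_d9
  have hk0 : (0 : ℝ) ≤ k := Nat.cast_nonneg k
  have h1 : Λ * (L - k) ≤ Λ * L := mul_le_mul_of_nonneg_left (by linarith) (by linarith)
  have h2 : Real.log (2 * m) * (L - k) ≤ (1 + L) * x := by
    rw [hlog2m]
    have := mul_le_mul_of_nonneg_left hw (show 0 ≤ 1 + L by linarith)
    linarith
  have h3 : (377 / 100 + x) * L ≤ Λ * L := mul_le_mul_of_nonneg_right hΛ (by linarith)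
  have h4 : 1 / 28 + (1 + L) * x ≤ (377 / 100 + x) * L := by nlinarith
  have h5 : 1 / 28 + (Λ + Real.log (2 * m)) * (L - k) ≤ 2 * (Λ * L) := by linarith
  have h6 := mul_le_mul_of_nonneg_left h5 (show 0 ≤ 56 * (d : ℝ) by linarith)
  linarith

theorem sum_real_DIS_le {m d : ℕ} {δ R b : ℝ} (hd : 1 ≤ d) (hdm : d ≤ m) (hm : 2 ≤ m)
    (hδ : 0 < δ) (hδ1 : δ ≤ 1) (hR : 0 ≤ R) (hb0 : 0 ≤ b)
    (hb : disCoeff PX F g (5 * R + 14 * (slackA m δ d / m)) ≤ b) :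
    ∑ t ∈ Finset.range m, PX.real (DIS (ball PX F g (ballRadius R δ d t)))
      ≤ b * (5 * (m * R) + 28 * slackA m δ d * Real.logb 2 m) := by
  have hd1 : (1 : ℝ) ≤ d := by exact_mod_cast hd
  have hm2 : (2 : ℝ) ≤ m := by exact_mod_cast hm
  have hm0 : (0 : ℝ) < m := by linarith
  have hA := le_slackA hd hdm hδ hδ1
  have hL1 : 1 ≤ Real.logb 2 m := by
    rw [Real.le_logb_iff_rpow_le one_lt_two hm0]; simpa using hm2
  set A := slackA m δ d with hAdef
  set ρ := 5 * R + 14 * (A / m) with hρ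
  have hA0 : 0 < A := by linarith
  have hρ0 : 0 < ρ := by positivity
  have hρm : m * ρ = 5 * (m * R) + 14 * A := by rw [hρ]; field_simp
  -- If `ρ ≥ 1`, every term is at most `ρ b`, which suffices. Otherwise `14A < m` with `A ≥ 15d`
  -- leaves room for `2 ^ k ≤ 2d ≤ m`.
  rcases le_or_gt 1 ρ with h1 | h1
  · calc _ ≤ ∑ _t ∈ Finset.range m, ρ * b := Finset.sum_le_sum fun t _ =>
          (real_DIS_le_real_DIS_ball_one _).trans (real_DIS_ball_le hρ0 hb h1 le_rfl)
      _ = b * (m * ρ) := by simp; ring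
      _ ≤ _ := by
        rw [hρm]
        refine mul_le_mul_of_nonneg_left ?_ hb0
        nlinarith
  · set k := Nat.clog 2 d with hk
    have hk1 : d ≤ 2 ^ k := Nat.le_pow_clog one_lt_two d
    have hk2 : 2 ^ k ≤ 2 * d := by
      rcases hd.eq_or_lt with h | h
      · rw [hk, ← h]; simp
      · have h3 := Nat.pow_pred_clog_lt_self one_lt_two h
        have h4 : 0 < k := Nat.clog_pos one_lt_two h
        rw [← hk] at h3
        obtain ⟨j, hj⟩ := Nat.exists_eq_add_of_lt h4
        rw [hj] at h3 ⊢
        simp only [zero_add, Nat.pred_eq_sub_one, Nat.add_sub_cancel, pow_succ] at h3 ⊢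
        omega
    have hAm : 14 * A < m := by nlinarith
    have hkm : 2 ^ k ≤ m := by
      have : (2 : ℝ) * d ≤ m := by linarith
      exact hk2.trans (by exact_mod_cast this)
    set W := 56 * d * (Real.log (16 * m * Real.exp 1 / (d * δ)) + Real.log (2 * m)) with hW
    have hlog2m : 0 ≤ Real.log (2 * m) := Real.log_nonneg (by linarith)
    have hAW : 14 * A ≤ W := by
      rw [hAdef, slackA_eq, hW]
      have := mul_nonneg (show 0 ≤ 56 * (d : ℝ) by linarith) hlog2m
      linarith
    have hearly : ∑ t ∈ Finset.Ico 0 (2 ^ k), PX.real (DIS (ball PX F g (ballRadius R δ d t)))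
        ≤ b * 2 ^ k := by
      -- The early terms are bounded by `b`, not by `1`, so that `b` factors out of the whole sum.
      calc _ ≤ ∑ _t ∈ Finset.Ico 0 (2 ^ k), 1 * b := Finset.sum_le_sum fun t _ =>
            (real_DIS_le_real_DIS_ball_one _).trans (real_DIS_ball_le hρ0 hb le_rfl h1.le)
        _ = _ := by simp; ring
    have hlate : ∑ t ∈ Finset.Ico (2 ^ k) m, PX.real (DIS (ball PX F g (ballRadius R δ d t)))
        ≤ b * (5 * (m * R) + W * (Real.logb 2 m - k)) := by
      calc _ ≤ ∑ t ∈ Finset.Ico (2 ^ k) m, b * (5 * R + W * ((2 : ℝ) ^ Nat.log 2 t)⁻¹) := by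
            refine Finset.sum_le_sum fun t ht => ?_
            rw [Finset.mem_Ico] at ht
            have ht0 : t ≠ 0 := by have := Nat.two_pow_pos k; omega
            have hlog : k ≤ Nat.log 2 t := Nat.le_log_of_pow_le one_lt_two ht.1
            have hpow : d ≤ 2 ^ Nat.log 2 t := hk1.trans (Nat.pow_le_pow_right two_pos hlog)
            have hpm : 2 ^ Nat.log 2 t ≤ m := (Nat.pow_log_le_self 2 ht0).trans ht.2.le
            have hpm' : (2 : ℝ) ^ Nat.log 2 t ≤ m := by exact_mod_cast hpm
            have h7 := seven_relSlack_le hd (Nat.two_pow_pos (Nat.log 2 t)) hpm hδ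
            push_cast at h7
            rw [ballRadius, if_pos ⟨ht0, hpow⟩, mul_comm b]
            refine real_DIS_ball_le hρ0 hb (by linarith) ?_
            -- The radius at time `t` must be replaced by a bound not below `ρ`, since `disCoeff` is
            -- only controlled there.
            have h8 : 14 * (A / m) ≤ W * ((2 : ℝ) ^ Nat.log 2 t)⁻¹ := by
              rw [← mul_div_assoc, div_eq_mul_inv]
              have hW0 : 0 ≤ W := by linarith
              gcongr
            linarith
        _ = b * (((m - 2 ^ k : ℕ) : ℝ) * (5 * R)
            + W * ∑ t ∈ Finset.Ico (2 ^ k) m, ((2 : ℝ) ^ Nat.log 2 t)⁻¹) := by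
            rw [← Finset.mul_sum, Finset.sum_add_distrib, Finset.sum_const, Nat.card_Ico,
              nsmul_eq_mul, Finset.mul_sum (f := fun t : ℕ => ((2 : ℝ) ^ Nat.log 2 t)⁻¹)]
        _ ≤ _ := by
            refine mul_le_mul_of_nonneg_left (add_le_add ?_ ?_) hb0
            · have : ((m - 2 ^ k : ℕ) : ℝ) ≤ m := by exact_mod_cast Nat.sub_le _ _
              nlinarith
            · exact mul_le_mul_of_nonneg_left (sum_inv_pow_log_le k hkm) (by linarith)
    rw [Finset.range_eq_Ico, ← Finset.sum_Ico_consecutive _ (Nat.zero_le _) hkm]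
    have hfin := slack_sum_le hd hk1 hk2 hkm hm hδ hδ1
    rw [← hW, ← hAdef] at hfin
    calc _ ≤ b * 2 ^ k + b * (5 * (m * R) + W * (Real.logb 2 m - k)) := add_le_add hearly hlate
      _ = b * (5 * (m * R) + (2 ^ k + W * (Real.logb 2 m - k))) := by ring
      _ ≤ _ := mul_le_mul_of_nonneg_left (by linarith) hb0

end Mean

/-! ### The number of requested labels -/

section Labels

variable {X : Type*} {F : Set (X → Bool)} {d : ℕ} {g : X → Bool}
  {erm : List (X × Bool) → X → Bool}

theorem labelsRequested_le (m : ℕ) (δ : ℝ) (z : ℕ → X × Bool) :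
    (labelsRequested F d erm m δ z : ℝ) ≤ m := by
  rw [labelsRequested, requested_eq_sum]
  calc _ ≤ ∑ _t ∈ Finset.range m, (1 : ℝ) := Finset.sum_le_sum fun t _ =>
        Set.indicator_le_self' (fun _ _ => zero_le_one) _
    _ = m := by simp

variable [MeasurableSpace X] {P : Measure (X × Bool)}

/-- The examples whose label may be requested at time `t` on a good stream, up to a null set. -/
def requestSet (P : Measure (X × Bool)) (F : Set (X → Bool)) (g : X → Bool) (δ : ℝ) (d t : ℕ) :
    Set (X × Bool) :=
  Prod.fst ⁻¹' toMeasurable P.fst (DIS (ball P.fst F g (ballRadius (risk P g) δ d t)))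

theorem measurableSet_requestSet (δ : ℝ) (t : ℕ) : MeasurableSet (requestSet P F g δ d t) :=
  measurable_fst (measurableSet_toMeasurable _ _)

theorem real_requestSet (δ : ℝ) (t : ℕ) : P.real (requestSet P F g δ d t)
    = P.fst.real (DIS (ball P.fst F g (ballRadius (risk P g) δ d t))) := by
  rw [measureReal_def, measureReal_def, requestSet,
    ← Measure.fst_apply (measurableSet_toMeasurable _ _), measure_toMeasurable]

variable [IsProbabilityMeasure P]

/-- The low-error sets depend on the past, but the sets counted on the right do not. Hence ordinary
independence suffices and no martingale argument is needed. -/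
theorem GoodStream.labelsRequested_le_hits (hFm : ∀ f ∈ F, Measurable f)
    (hmin : IsRiskMinimizer P F g) (hd : 1 ≤ d) (herm : ∀ S, IsERM F S (erm S)) {δ : ℝ}
    (hδ : 0 < δ) (hδ1 : δ ≤ 1) {z : ℕ → X × Bool} (hgood : GoodStream P F g d (δ / 2) z) (m : ℕ) :
    (labelsRequested F d erm m (δ / 2) z : ℝ)
      ≤ hits (Finset.range m) (fun t => requestSet P F g δ d t) z := by
  rw [labelsRequested, requested_eq_sum, hits]
  refine Finset.sum_le_sum fun t _ => ?_
  have hsub : (run F d erm (δ / 2) z t).lowError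
      ⊆ ball P.fst F g (ballRadius (risk P g) δ d t) := by
    unfold ballRadius
    split_ifs with h
    · rw [lowError_eq_log F d erm (δ / 2) z h.1]
      exact (hgood.lowError hFm hmin hd herm (half_pos hδ) (by linarith) _ h.2).2
    · exact (lowError_subset F d erm (δ / 2) z t).trans (subset_ball_of_one_le le_rfl)
  by_cases hz : (z t).1 ∈ DIS (run F d erm (δ / 2) z t).lowError
  · have hz' : z t ∈ requestSet P F g δ d t := subset_toMeasurable _ _ (DIS_mono hsub hz)
    rw [Set.indicator_of_mem hz, Set.indicator_of_mem hz']
  · rw [Set.indicator_of_notMem hz]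
    exact Set.indicator_nonneg (fun _ _ => zero_le_one) _

theorem risk_lt_scale {m : ℕ} {δ : ℝ} (hd : 1 ≤ d) (hdm : d ≤ m) (hδ : 0 < δ) (hδ1 : δ ≤ 1) {R : ℝ}
    (hR : 0 ≤ R) : R + 1 / m ≤ 5 * R + 14 * (slackA m δ d / m) := by
  have hm0 : (0 : ℝ) < m := by exact_mod_cast hd.trans hdm
  have hd1 : (1 : ℝ) ≤ d := by exact_mod_cast hd
  have hA := le_slackA hd hdm hδ hδ1
  have h1 : 1 / (m : ℝ) ≤ slackA m δ d / m := by gcongr; linarith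
  have h2 : 0 < 1 / (m : ℝ) := by positivity
  linarith

theorem measure_labelBound_lt_le {φ : ℝ → ℝ} (hφ : IsPolylog φ) (hF : PointwiseMeasurable F)
    (hvc : HasVCDim F d) (hd : 1 ≤ d) (herm : ∀ S, IsERM F S (erm S))
    (hmin : IsRiskMinimizer P F g)
    (hθ : ∀ r, risk P g < r → disCoeff P.fst F g r ≤ φ (1 / r)) {m : ℕ} {δ : ℝ} (hdm : d ≤ m)
    (hδ : 0 < δ) (hδ1 : δ < 1) :
    Measure.infinitePi (fun _ : ℕ => P)
      {z | labelBound φ (risk P g) m d δ < labelsRequested F d erm m (δ / 2) z}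
      ≤ ENNReal.ofReal δ := by
  have hR : 0 ≤ risk P g := measureReal_nonneg
  have hm0 : (0 : ℝ) < m := by exact_mod_cast hd.trans hdm
  have hscale := risk_lt_scale hd hdm hδ hδ1.le hR
  have hinv : 0 < 1 / (m : ℝ) := by positivity
  have hρ0 : 0 < 5 * risk P g + 14 * (slackA m δ d / m) := by linarith
  have hb0 := hφ.1 _ (one_div_pos.2 hρ0)
  have hb := hθ (5 * risk P g + 14 * (slackA m δ d / m)) (by linarith)
  set b := φ (1 / (5 * risk P g + 14 * (slackA m δ d / m))) with hbdef
  have hbound : labelBound φ (risk P g) m d δ = 2 * Real.exp 1 *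
      (b * (5 * (m * risk P g) + 28 * slackA m δ d * Real.logb 2 m))
        + Real.logb 2 (1 / (δ / 2)) := by
    rw [labelBound, ← hbdef, one_div_div]; ring
  -- For `m = 1` the factor `log₂ m` vanishes and the bound on the mean is unavailable; the single
  -- possible request is covered by `log₂ (2/δ) ≥ 1`.
  rcases (hd.trans hdm).eq_or_lt with hm1 | hm2
  · have hempty : {z | labelBound φ (risk P g) m d δ
        < labelsRequested F d erm m (δ / 2) z} = ∅ := by
      refine Set.eq_empty_of_forall_notMem fun z hz => ?_
      have h1 := labelsRequested_le (F := F) (d := d) (erm := erm) m (δ / 2) z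
      have h2 : 1 ≤ Real.logb 2 (1 / (δ / 2)) := by
        rw [Real.le_logb_iff_rpow_le one_lt_two (by positivity), one_div_div, Real.rpow_one,
          le_div_iff₀ hδ]
        linarith
      have h3 : Real.logb 2 (m : ℝ) = 0 := by rw [← hm1]; simp
      have hz' : labelBound φ (risk P g) m d δ < labelsRequested F d erm m (δ / 2) z := hz
      rw [hbound, h3] at hz'
      have h4 : 0 ≤ 2 * Real.exp 1 *
          (b * (5 * (m * risk P g) + 28 * slackA m δ d * 0)) := by
        rw [mul_zero, add_zero]; positivity
      have h5 : (m : ℝ) = 1 := by rw [← hm1]; simp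
      linarith
    rw [hempty, measure_empty]
    exact zero_le
  · have hsum := sum_real_DIS_le (PX := P.fst) (F := F) (g := g) hd hdm hm2 hδ hδ1.le hR hb0 hb
    simp_rw [← real_requestSet] at hsum
    have hchern := measure_lt_hits_le (fun _ : ℕ => P) (Finset.range m)
      (B := fun t => requestSet P F g δ d t) (fun t => measurableSet_requestSet δ t) hsum
      (half_pos hδ)
    rw [← hbound] at hchern
    -- Running at confidence `δ/2` spends one half of `δ` on the stream; the other half went to the
    -- Chernoff bound.
    have hgood := measure_not_goodStream_le (F := F) (d := d) P hF hvc.2 hd hmin.1 (half_pos hδ)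
      (by linarith)
    refine (measure_mono (t := {z | ¬ GoodStream P F g d (δ / 2) z} ∪
      {z | labelBound φ (risk P g) m d δ
        < hits (Finset.range m) (fun t => requestSet P F g δ d t) z}) fun z hz => ?_).trans
      ((measure_union_le _ _).trans ((add_le_add hgood hchern).trans_eq ?_))
    · by_cases hg : GoodStream P F g d (δ / 2) z
      · refine Or.inr (lt_of_lt_of_le (show labelBound φ (risk P g) m d δ
          < labelsRequested F d erm m (δ / 2) z from hz) ?_)
        exact hg.labelsRequested_le_hits hF.1 hmin hd herm hδ hδ1.le m
      · exact Or.inl hg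
    · rw [← ENNReal.ofReal_add (by positivity) (by positivity), add_halves]

end Labels

/-! ### Poly-logarithmic bounds -/

section Polylog

/-- The term `polylog₃` of the speedup bound. -/
def speedupTerm (φ : ℝ → ℝ) (m d : ℕ) (x : ℝ) : ℝ :=
  d + Real.logb 2 (2 * x)
    + 56 * Real.exp 1 * Real.logb 2 m * (4 * d * Real.log (16 * Real.exp 1 * (m * x))) * φ m

theorem IsPolylog.const_mul {φ : ℝ → ℝ} (hφ : IsPolylog φ) {c : ℝ} (hc : 0 ≤ c) :
    IsPolylog fun x => c * φ x := by
  obtain ⟨h0, hmono, C, k, hC⟩ := hφ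
  refine ⟨fun x hx => mul_nonneg hc (h0 x hx),
    fun x hx y hy hxy => mul_le_mul_of_nonneg_left (hmono hx hy hxy) hc, c * C, k, fun x hx => ?_⟩
  rw [mul_assoc]
  exact mul_le_mul_of_nonneg_left (hC x hx) hc

theorem logb_two_le {x : ℝ} (hx : 1 ≤ x) : Real.logb 2 x ≤ 2 * Real.log x := by
  have h := Real.log_two_gt_d9
  have hx0 := Real.log_nonneg hx
  rw [Real.logb, div_le_iff₀ (by linarith)]
  nlinarith

theorem log_sixteen_exp_mul_nonneg {x : ℝ} (hx : 1 ≤ x) :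
    0 ≤ Real.log (16 * Real.exp 1 * x) := by
  apply Real.log_nonneg
  have := Real.exp_one_gt_d9
  nlinarith

theorem le_speedupTerm {φ : ℝ → ℝ} (hφ : IsPolylog φ) {m d : ℕ} {x : ℝ} (hm : 1 ≤ m)
    (hx : 1 ≤ x) : (d : ℝ) ≤ speedupTerm φ m d x := by
  have hm1 : (1 : ℝ) ≤ m := by exact_mod_cast hm
  have hφ0 := hφ.1 m (by linarith)
  have h1 : 0 ≤ Real.logb 2 (2 * x) := Real.logb_nonneg one_lt_two (by linarith)
  have h2 : 0 ≤ Real.logb 2 (m : ℝ) := Real.logb_nonneg one_lt_two hm1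
  have h3 := log_sixteen_exp_mul_nonneg (one_le_mul_of_one_le_of_one_le hm1 hx)
  have h4 : 0 ≤ 56 * Real.exp 1 * Real.logb 2 m
      * (4 * d * Real.log (16 * Real.exp 1 * (m * x))) * φ m := by positivity
  unfold speedupTerm
  linarith

theorem isPolylogTerm_speedupTerm {φ : ℝ → ℝ} (hφ : IsPolylog φ) :
    IsPolylogTerm (speedupTerm φ) := by
  obtain ⟨C, k, hC⟩ := hφ.2.2
  have hC0 : 0 ≤ C := by
    have h1 := hφ.1 1 one_pos
    have h2 := hC 1 le_rfl
    simp at h2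
    linarith
  refine ⟨3 + 5376 * C, k + 2, fun m d x hm hd hx =>
    ⟨(Nat.cast_nonneg d).trans (le_speedupTerm hφ hm hx), ?_⟩⟩
  have hm1 : (1 : ℝ) ≤ m := by exact_mod_cast hm
  have hd1 : (1 : ℝ) ≤ d := by exact_mod_cast hd
  have hlm := Real.log_nonneg hm1
  have hlx := Real.log_nonneg hx
  have hl2 := Real.log_two_gt_d9
  have hl2' := Real.log_two_lt_d9
  have he := Real.exp_one_lt_d9
  set a := Real.log m
  set c := Real.log x
  set U := (1 + a) * (1 + c) with hU
  have hac : 0 ≤ a * c := mul_nonneg hlm hlx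
  have hUexp : U = 1 + a + c + a * c := by rw [hU]; ring
  have hU1 : 1 ≤ U := by linarith
  have hUpow : U ≤ U ^ (k + 2) := le_self_pow₀ hU1 (by omega)
  have h1 : Real.logb 2 (2 * x) ≤ 2 * U := by
    rw [Real.logb_mul two_ne_zero (by linarith), Real.logb_self_eq_one one_lt_two]
    have := logb_two_le hx
    linarith
  have h2 : Real.logb 2 (m : ℝ) ≤ 2 * U := by
    have := logb_two_le hm1
    linarith
  have h2' : 0 ≤ Real.logb 2 (m : ℝ) := Real.logb_nonneg one_lt_two hm1
  have h3 : Real.log (16 * Real.exp 1 * (m * x)) ≤ 4 * U := by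
    rw [Real.log_mul (by positivity) (by positivity), log_sixteen_exp,
      Real.log_mul (by positivity) (by positivity)]
    change 4 * Real.log 2 + 1 + (a + c) ≤ 4 * U
    linarith
  have h4 : φ m ≤ C * U ^ k := by
    refine (hC m hm1).trans (mul_le_mul_of_nonneg_left (pow_le_pow_left₀ (by linarith) ?_ k) hC0)
    change 1 + a ≤ U
    linarith
  have hφ0 := hφ.1 m (by linarith)
  have h5 : 56 * Real.exp 1 * Real.logb 2 m
      * (4 * d * Real.log (16 * Real.exp 1 * (m * x))) * φ m
      ≤ 56 * 3 * (2 * U) * (4 * d * (4 * U)) * (C * U ^ k) := by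
    have := log_sixteen_exp_mul_nonneg (one_le_mul_of_one_le_of_one_le hm1 hx)
    gcongr
    linarith
  have h6 : (d : ℝ) + 2 * U ≤ 3 * d * U := by nlinarith
  have h7 : 3 * (d : ℝ) * U ≤ 3 * d * U ^ (k + 2) := by gcongr
  unfold speedupTerm
  calc _ ≤ 3 * d * U ^ (k + 2) + 56 * 3 * (2 * U) * (4 * d * (4 * U)) * (C * U ^ k) := by linarith
    _ = _ := by rw [pow_add]; ring

/-- The scale `5R + 14A/m` is at least `R + 1/m` and at least `1/m`. By monotonicity the same value
of `φ` is bounded by `φ (1 / (R + 1/m))` in the main term and by `φ m` in the remainder. -/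
theorem labelBound_le_speedup {φ : ℝ → ℝ} (hφ : IsPolylog φ) {m d : ℕ} {δ R : ℝ} (hd : 1 ≤ d)
    (hdm : d ≤ m) (hδ : 0 < δ) (hδ1 : δ ≤ 1) (hR : 0 ≤ R) :
    labelBound φ R m d δ
      ≤ 10 * Real.exp 1 * φ (1 / (R + 1 / m)) * R * m + speedupTerm φ m d (1 / δ) := by
  have hm1 : (1 : ℝ) ≤ m := by exact_mod_cast hd.trans hdm
  have hm0 : (0 : ℝ) < m := by linarith
  have hd1 : (1 : ℝ) ≤ d := by exact_mod_cast hd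
  have hscale := risk_lt_scale hd hdm hδ hδ1 hR
  have hA := le_slackA hd hdm hδ hδ1
  have hinv : 0 < 1 / (m : ℝ) := by positivity
  have hb0 := hφ.1 (1 / (5 * R + 14 * (slackA m δ d / m))) (one_div_pos.2 (by linarith))
  have hb1 : φ (1 / (5 * R + 14 * (slackA m δ d / m))) ≤ φ (1 / (R + 1 / m)) :=
    hφ.2.1 (Set.mem_Ioi.2 (one_div_pos.2 (by linarith)))
      (Set.mem_Ioi.2 (one_div_pos.2 (by linarith))) (one_div_le_one_div_of_le (by linarith) hscale)
  have hb2 : φ (1 / (5 * R + 14 * (slackA m δ d / m))) ≤ φ m := by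
    refine hφ.2.1 (Set.mem_Ioi.2 (one_div_pos.2 (by linarith))) (Set.mem_Ioi.2 hm0) ?_
    rw [one_div_le (by linarith) hm0]
    linarith
  have hL0 : 0 ≤ Real.logb 2 (m : ℝ) := Real.logb_nonneg one_lt_two hm1
  have hslack : slackA m δ d ≤ 4 * d * Real.log (16 * Real.exp 1 * (m * (1 / δ))) := by
    rw [slackA_eq]
    refine mul_le_mul_of_nonneg_left (Real.log_le_log (by positivity) ?_) (by positivity)
    rw [show 16 * Real.exp 1 * (m * (1 / δ)) = 16 * m * Real.exp 1 / δ by ring]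
    exact div_le_div_of_nonneg_left (by positivity) hδ (by nlinarith)
  set b := φ (1 / (5 * R + 14 * (slackA m δ d / m)))
  have t1 : b * (10 * Real.exp 1) * (m * R) ≤ 10 * Real.exp 1 * φ (1 / (R + 1 / m)) * R * m := by
    calc _ = 10 * Real.exp 1 * b * R * m := by ring
      _ ≤ _ := by gcongr
  have hS0 : 0 ≤ slackA m δ d := by linarith
  have t3 : 56 * Real.exp 1 * Real.logb 2 m * slackA m δ d * b
      ≤ 56 * Real.exp 1 * Real.logb 2 m
        * (4 * d * Real.log (16 * Real.exp 1 * (m * (1 / δ)))) * φ m := by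
    have := hS0.trans hslack
    gcongr
  have t2 : Real.logb 2 (2 / δ) = Real.logb 2 (2 * (1 / δ)) := by rw [mul_one_div]
  unfold labelBound speedupTerm
  rw [t2]
  linarith

end Polylog

end ActiveILESS

end

open ActiveILESS
theorem theorem6 (φ : ℝ → ℝ) (hφ : IsPolylog φ) :
    ∃ (φ₂ : ℝ → ℝ) (φ₃ : ℕ → ℕ → ℝ → ℝ), IsPolylog φ₂ ∧ IsPolylogTerm φ₃ ∧
      ∀ (X : Type*) [MeasurableSpace X] (F : Set (X → Bool)) (d : ℕ) (fstar : X → Bool)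
        (erm : List (X × Bool) → X → Bool),
        PointwiseMeasurable F → HasVCDim F d → 1 ≤ d → (∀ S, IsERM F S (erm S)) →
        (∀ (P : Measure (X × Bool)) [IsProbabilityMeasure P], IsRiskMinimizer P F fstar →
          (∀ r, risk P fstar < r → disCoeff P.fst F fstar r ≤ φ (1 / r)) →
          ∀ (m : ℕ) (δ : ℝ), d ≤ m → 0 < δ → δ < 1 →
            Measure.infinitePi (fun _ : ℕ => P)
              {z | labelBound φ (risk P fstar) m d δ
                    < labelsRequested F d erm m (δ / 2) z} ≤ ENNReal.ofReal δ ∧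
            labelBound φ (risk P fstar) m d δ
              ≤ φ₂ (1 / (risk P fstar + 1 / m)) * risk P fstar * m + φ₃ m d (1 / δ)) ∧
        (∀ (PX : Measure X) [IsProbabilityMeasure PX], fstar ∈ F →
          (∀ r, 0 < r → disCoeff PX F fstar r ≤ φ (1 / r)) →
          HasRStarExponentialSpeedup PX F d fstar
            (fun m δ z => labelsRequested F d erm m (δ / 2) z) φ₂ φ₃) := by
  refine ⟨fun x => 10 * Real.exp 1 * φ x, speedupTerm φ, hφ.const_mul (by positivity),
    isPolylogTerm_speedupTerm hφ, ?_⟩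
  intro X _ F d fstar erm hF hvc hd herm
  refine ⟨fun P _ hmin hθ m δ hdm hδ hδ1 =>
    ⟨measure_labelBound_lt_le hφ hF hvc hd herm hmin hθ hdm hδ hδ1,
      labelBound_le_speedup hφ hd hdm hδ hδ1.le measureReal_nonneg⟩, ?_⟩
  intro PX _ _ hθ P _ hPX hmin m δ hm hδ hδ1
  subst hPX
  have hR : 0 ≤ risk P fstar := measureReal_nonneg
  have hm0 : (0 : ℝ) < m := by exact_mod_cast hm
  rcases le_or_gt d m with hdm | hmd
  · refine (measure_mono fun z hz => ?_).trans (measure_labelBound_lt_le hφ hF hvc hd herm hmin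
      (fun r hr => hθ r (hR.trans_lt hr)) hdm hδ hδ1)
    exact (labelBound_le_speedup hφ hd hdm hδ hδ1.le hR).trans_lt hz
  -- For `m < d` at most `m` labels can be requested; the summand `d` in `speedupTerm` is there for
  -- this case.
  · have hempty : {z | 10 * Real.exp 1 * φ (1 / (risk P fstar + 1 / m)) * risk P fstar * m
        + speedupTerm φ m d (1 / δ) < labelsRequested F d erm m (δ / 2) z} = ∅ := by
      refine Set.eq_empty_of_forall_notMem fun z hz => ?_
      have hz' : 10 * Real.exp 1 * φ (1 / (risk P fstar + 1 / m)) * risk P fstar * m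
        + speedupTerm φ m d (1 / δ) < labelsRequested F d erm m (δ / 2) z := hz
      have h1 := labelsRequested_le (F := F) (d := d) (erm := erm) m (δ / 2) z
      have h2 : (m : ℝ) ≤ d := by exact_mod_cast hmd.le
      have h3 := le_speedupTerm hφ (d := d) hm ((one_le_div hδ).2 hδ1.le)
      have h4 := hφ.1 (1 / (risk P fstar + 1 / m)) (by positivity)
      have h5 : 0 ≤ 10 * Real.exp 1 * φ (1 / (risk P fstar + 1 / m)) * risk P fstar * m := by
        positivity
      linarith
    exact (measure_mono_null (fun z hz => hz) (hempty ▸ measure_empty)).trans_le zero_le
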